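/- \textbf{Setting.} Let $\mathcal S$ be a finite set, $\pi$ a probability vector and $a$ a stochastic matrix on $\mathcal S$ ($a(x,y)$ is the probability of moving from $x$ to $y$), $\nu$ a $\sigma$-finite measure on a measurable space $\mathcal Z$, and $f(\cdot|x)$ ($x\in\mathcal S$) and $f(\cdot|\theta_0)$ probability densities with respect to $\nu$. Under $H_0$ the measurements $Z_1,Z_2,\dots$ are i.i.d. with density $f(\cdot|\theta_0)$. Under $H_1$, $\{(X_i,Z_i)\}_{i\ge1}$ is a hidden Markov model: $X$ is a Markov chain with initial distribution $\pi$ and transition matrix $a$, and given $X$ the $Z_i$ are independent with densities $f(\cdot|X_i)$. Put $$\Lambda_k(\mathbf z_{1:k})=\sum_{\mathbf x_{1:k}\in\mathcal S^k}\pi(x_1)\prod_{i=2}^k a(x_{i-1},x_i)\prod_{i=1}^k\frac{f(z_i|x_i)}{f(z_i|\theta_0)} .$$ For $0<\gamma_0<1<\gamma_1<\infty$ the SPRT with boundaries $\gamma_0,\gamma_1$ stops at $\tau=\inf\{k\ge1:\Lambda_k(\mathbf Z_{1:k})\notin(\gamma_0,\gamma_1)\}$ and accepts $H_1$ if $\Lambda_\tau\ge\gamma_1$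 and $H_0$ if $\Lambda_\tau\le\gamma_0$. For $\alpha',\beta'\in(0,1)$ let $\mathscr T(\alpha',\beta')$ be the class of non-randomized tests $(N,d)$ based on $Z_1,Z_2,\dots$ (with stopping time $N\in\{1,2,\dots\}\cup\{\infty\}$ and terminal decision $d$) such that $P(N<\infty,\ d \text{ accepts } H_1\,|\,H_0)\le\alpha'$ and $P(N<\infty,\ d\text{ accepts }H_0\,|\,H_1)\le\beta'$. \textbf{Theorem.} Assume: (1) the chain $X$ is stationary, irreducible and aperiodic; (2) for every probability vector $c$ on $\mathcal S$, $\sum_{x}c(x)f(\cdot|x)$ is not $\nu$-a.e. equal to $f(\cdot|\theta_0)$; (3) $\operatorname E_{H_i}\big[\,\big|\ln\frac{f(Z_1|x)}{f(Z_1|\theta_0)}\big|\,\big]<\infty$ for every $x\in\mathcal S$ and $i=0,1$. Then the limits $\lambda_i=\lim_{k\to\infty}k^{-1}\operatorname E_{H_i}[\ln\Lambda_k(\mathbf Z_{1:k})]$, $i=0,1$, exist and are finite, with $\lambda_0<0<\lambda_1$, and the following holds. Suppose that for each pair of error bounds $(\alpha',\beta')$ considered the boundaries $\gamma_0,\gamma_1$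 are chosen so that the SPRT belongs to $\mathscr T(\alpha',\beta')$, and that $\ln\gamma_1\sim\ln\frac1{\alpha'}$ and $\ln\gamma_0\sim\ln\beta'$ as $\alpha'+\beta'\to0$. Then, as $\alpha'+\beta'\to0$, $$\frac{\tau}{|\ln\beta'|}\to\frac1{|\lambda_0|}\ \text{ a.s. under }H_0,\qquad \frac{\tau}{|\ln\alpha'|}\to\frac1{\lambda_1}\ \text{ a.s. under }H_1,$$ and, for every $\varepsilon\in(0,1)$ and $i=0,1$, $$\inf_{(N,d)\in\mathscr T(\alpha',\beta')}P\big(N>\varepsilon\tau\,\big|\,H_i\big)\to1 .$$ -/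

import Mathlib

open MeasureTheory ProbabilityTheory Filter Topology Set
open scoped ENNReal

namespace SeqHMM

/-- Parameters of the detection problem. The state space `S` is finite; `start` is the initial
distribution and `trans x y` the probability of moving from `x` to `y`; `f x` is the density of a
measurement when the state is `x`, and `f₀` is the density of a measurement under noise only, all
with respect to `ν`. -/
structure Model (S : Type*) [Fintype S] [DecidableEq S] (𝒵 : Type*) [MeasurableSpace 𝒵]
    (ν : Measure 𝒵) where
  start : S → ℝ
  start_mem : start ∈ stdSimplex ℝ S
  trans : Matrix S S ℝ
  trans_mem : trans ∈ Matrix.rowStochastic ℝ S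
  f : S → 𝒵 → ℝ
  f_measurable : ∀ x, Measurable (f x)
  f_nonneg : ∀ x z, 0 ≤ f x z
  f_lintegral : ∀ x, ∫⁻ z, ENNReal.ofReal (f x z) ∂ν = 1
  f₀ : 𝒵 → ℝ
  f₀_measurable : Measurable f₀
  f₀_nonneg : ∀ z, 0 ≤ f₀ z
  f₀_lintegral : ∫⁻ z, ENNReal.ofReal (f₀ z) ∂ν = 1

section

variable {S : Type*} [Fintype S] [DecidableEq S] {𝒵 : Type*} [MeasurableSpace 𝒵] {ν : Measure 𝒵}

/-- Probability of a trajectory: `start (x 0) * trans (x 0) (x 1) * ⋯ * trans (x (k-2)) (x (k-1))`.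
Times are indexed from `0`, so that `x 0, …, x (k-1)` stand for the first `k` states. -/
def Model.trajProb (M : Model S 𝒵 ν) : (k : ℕ) → (Fin k → S) → ℝ
  | 0, _ => 1
  | k + 1, x => M.start (x 0) * ∏ i : Fin k, M.trans (x i.castSucc) (x i.succ)

/-- The likelihood ratio `Λ_k` of `signal present` to `noise only`, based on `k` measurements:
the average over all trajectories of the conditional likelihood ratios. -/
noncomputable def Model.lr (M : Model S 𝒵 ν) (k : ℕ) (z : Fin k → 𝒵) : ℝ :=
  ∑ x : Fin k → S, M.trajProb k x * ((∏ i, M.f (x i) (z i)) / ∏ i, M.f₀ (z i))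

theorem Model.measurable_lr (M : Model S 𝒵 ν) (k : ℕ) : Measurable (M.lr k) := by
  unfold Model.lr
  refine Finset.measurable_sum _ fun x _ => Measurable.const_mul (Measurable.div ?_ ?_) _
  · exact Finset.measurable_prod _ fun i _ => (M.f_measurable (x i)).comp (measurable_pi_apply i)
  · exact Finset.measurable_prod _ fun i _ => M.f₀_measurable.comp (measurable_pi_apply i)

/-- The chain is stationary, irreducible and aperiodic (the return times of each state have
greatest common divisor one). -/
structure Model.Ergodic (M : Model S 𝒵 ν) : Prop where
  stationary : Matrix.vecMul M.start M.trans = M.start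
  irreducible : M.trans.IsIrreducible
  aperiodic : ∀ x : S, ∀ d : ℕ, (∀ n : ℕ, 1 ≤ n → 0 < (M.trans ^ n) x x → d ∣ n) → d = 1

/-- No mixture of the signal densities is equal to the noise density `ν`-almost everywhere. -/
def Model.Distinguishable (M : Model S 𝒵 ν) : Prop :=
  ∀ c ∈ stdSimplex ℝ S, ¬ ((fun z => ∑ x, c x * M.f x z) =ᵐ[ν] M.f₀)

variable {Ω : Type*} [MeasurableSpace Ω]

/-- Under `P` the log-likelihood ratio `ln (f x / f₀)` of the first measurement has finite absolute
expectation for each state `x`. As `Real.log 0 = 0` and `a / 0 = 0` in Lean, it is required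
separately that the logarithm is almost surely finite, that is, that both densities are almost
surely positive. -/
def Model.FiniteLogMoment (M : Model S 𝒵 ν) (P : Measure Ω) (Z : ℕ → Ω → 𝒵) : Prop :=
  ∀ x, (∀ᵐ ω ∂P, 0 < M.f x (Z 0 ω) ∧ 0 < M.f₀ (Z 0 ω)) ∧
    Integrable (fun ω => Real.log (M.f x (Z 0 ω) / M.f₀ (Z 0 ω))) P

/-- Noise only: under `P` the measurements are i.i.d. with density `f₀`. -/
structure Model.IsNoise (M : Model S 𝒵 ν) (P : Measure Ω) (Z : ℕ → Ω → 𝒵) : Prop where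
  measurable : ∀ i, Measurable (Z i)
  indep : iIndepFun Z P
  law : ∀ i, P.map (Z i) = ν.withDensity fun z => ENNReal.ofReal (M.f₀ z)

/-- Signal present: under `P` the pair `(X, Z)` is a hidden Markov model, that is, `X` is the Markov
chain with the given initial and transition probabilities, and given the states the measurements
are independent, the `i`-th one having density `f (X i)`. -/
structure Model.IsSignal (M : Model S 𝒵 ν) (P : Measure Ω) (X : ℕ → Ω → S) (Z : ℕ → Ω → 𝒵) :
    Prop where
  measurable_state : ∀ i x, MeasurableSet (X i ⁻¹' {x})
  measurable : ∀ i, Measurable (Z i)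
  law : ∀ (k : ℕ) (x : Fin k → S) (A : Fin k → Set 𝒵), (∀ i, MeasurableSet (A i)) →
    P {ω | ∀ i : Fin k, X i ω = x i ∧ Z i ω ∈ A i} =
      ENNReal.ofReal (M.trajProb k x) *
        ∏ i, ∫⁻ z in A i, ENNReal.ofReal (M.f (x i) z) ∂ν

end

/-- The first `k` measurements. -/
def pre {𝒵 : Type*} (k : ℕ) (z : ℕ → 𝒵) : Fin k → 𝒵 := fun i => z i

/-- A non-randomized sequential test of `noise only` against `signal present`. After `k`
measurements (`k ≥ 1`) sampling stops if they lie in `halt k`; when sampling stops at `k`, the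
decision is `signal present` if they lie in `accept k`, and `noise only` otherwise. Tests of fixed
sample size are those for which `halt k` is everything for one `k` and empty for the others. -/
structure SeqTest (𝒵 : Type*) [MeasurableSpace 𝒵] where
  halt : (k : ℕ) → Set (Fin k → 𝒵)
  halt_measurable : ∀ k, MeasurableSet (halt k)
  accept : (k : ℕ) → Set (Fin k → 𝒵)
  accept_measurable : ∀ k, MeasurableSet (accept k)

section

variable {𝒵 : Type*} [MeasurableSpace 𝒵] {Ω : Type*} [MeasurableSpace Ω]

/-- The stopping time of a test: the least `k ≥ 1` at which sampling stops, `⊤` if there is none. -/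
noncomputable def SeqTest.time (T : SeqTest 𝒵) (z : ℕ → 𝒵) : ℕ∞ :=
  ⨅ (k : ℕ) (_ : 1 ≤ k ∧ pre k z ∈ T.halt k), (k : ℕ∞)

/-- Probability, under the law `P₀` of noise only, of stopping and deciding `signal present`. -/
noncomputable def SeqTest.errI (T : SeqTest 𝒵) (P₀ : Measure Ω) (Z : ℕ → Ω → 𝒵) : ℝ≥0∞ :=
  P₀ {ω | ∃ k : ℕ, T.time (fun i => Z i ω) = k ∧ pre k (fun i => Z i ω) ∈ T.accept k}

/-- Probability, under the law `P₁` of signal present, of stopping and deciding `noise only`. -/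
noncomputable def SeqTest.errII (T : SeqTest 𝒵) (P₁ : Measure Ω) (Z : ℕ → Ω → 𝒵) : ℝ≥0∞ :=
  P₁ {ω | ∃ k : ℕ, T.time (fun i => Z i ω) = k ∧ pre k (fun i => Z i ω) ∉ T.accept k}

/-- The class of tests with error probabilities of the first and second kind at most `α` and `β`. -/
def testClass (P₀ P₁ : Measure Ω) (Z : ℕ → Ω → 𝒵) (α β : ℝ) : Set (SeqTest 𝒵) :=
  {T | T.errI P₀ Z ≤ ENNReal.ofReal α ∧ T.errII P₁ Z ≤ ENNReal.ofReal β}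

variable {S : Type*} [Fintype S] [DecidableEq S] {ν : Measure 𝒵}

/-- The sequential probability ratio test with boundaries `γ₀` and `γ₁`: it stops as soon as the
likelihood ratio leaves `(γ₀, γ₁)`, and then decides `signal present` if the ratio is at
least `γ₁`. -/
noncomputable def Model.sprt (M : Model S 𝒵 ν) (γ₀ γ₁ : ℝ) : SeqTest 𝒵 where
  halt k := {z | M.lr k z ∉ Ioo γ₀ γ₁}
  halt_measurable k := ((M.measurable_lr k) measurableSet_Ioo).compl
  accept k := {z | γ₁ ≤ M.lr k z}
  accept_measurable k := (M.measurable_lr k) measurableSet_Ici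

/-- `c` is the limit of `k⁻¹ E[ln Λ_k]`, the expectations being taken under `P` (and existing). -/
def Model.IsLogRate (M : Model S 𝒵 ν) (P : Measure Ω) (Z : ℕ → Ω → 𝒵) (c : ℝ) : Prop :=
  (∀ k, Integrable (fun ω => Real.log (M.lr k (pre k fun i => Z i ω))) P) ∧
    Tendsto (fun k : ℕ => (k : ℝ)⁻¹ * ∫ ω, Real.log (M.lr k (pre k fun i => Z i ω)) ∂P)
      atTop (𝓝 c)

end

end SeqHMM

/-! Everything rests on the near-multiplicativity of $\Lambda_k$ along the shift. A power $a^r$ of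
the transition matrix has all entries at least some $c>0$, so the likelihood ratio of any stretch of
measurements depends on the initial state only up to a factor $D=e^{2L_r}/c$, where $L_r$ is the sum
of all $|\ln(f(z_i|x)/f(z_i|\theta_0))|$ over the first $r$ measurements of the stretch
(`Model.lrFrom_le_mul_lrFrom`). Hence $\ln\Lambda_{m+n}$ differs from
$\ln\Lambda_m+\ln\Lambda_n\circ\theta^m$ by at most $\ln D\circ\theta^m$, an integrable error. For
such a sequence the linear growth, almost surely and in mean, follows from Birkhoff's theorem
applied to each single term (`exists_rate_of_almost_additive_cocycle`); no subadditive ergodic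
theorem is needed. Birkhoff's theorem requires ergodicity of the shift: under $H_0$ it comes from
independence, under $H_1$ from $\Lambda_{2n}\ge\Lambda_n\,(\Lambda_n/D)\circ\theta^n$, which
prevents distant events from being too negatively correlated.

The signs of the rates come from the Hellinger affinity. By compactness of the simplex, every
mixture of signal densities has affinity at most some $\rho<1$ with the noise density, so
$E_0\sqrt{\Lambda_k}\le\rho^k$, and Jensen's inequality gives $\lambda_0\le2\ln\rho<0$. As
$\Lambda_k$ is a density, $E_1\Lambda_k^{-1/2}=E_0\Lambda_k^{1/2}$, which gives
$\lambda_1\ge-2\ln\rho>0$ (`Model.logRate_noise_neg`, `Model.logRate_signal_pos`).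

The asymptotics of $\tau$ are then a pathwise statement about a sequence with linear drift
(`tendsto_exit_time`). For optimality, a change of measure at the stopping time of a competing test
bounds the $H_0$-probability of stopping while $\ln\Lambda_N\ge-C$ by $e^C\beta'+\alpha'$. With
$C=s|\ln\beta'|$, $s<1$, this vanishes uniformly over the class, whereas at all times up to about
$\varepsilon\tau$ the process is still above $-C$ with high probability (`tendsto_iInf_measure_lt`).
The case of $H_1$ is the same for $-\ln\Lambda$. -/

namespace SeqHMM

/-! ### Birkhoff's theorem and almost additive sequences over an ergodic map. -/

section ErgodicTheorem

variable {α : Type*} {θ : α → α}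

/-- The running maximum of the Birkhoff sums of orders `1, …, n + 1`, defined recursively. -/
noncomputable def maxBirkhoff (θ : α → α) (f : α → ℝ) : ℕ → α → ℝ
  | 0, x => f x
  | n + 1, x => f x + max 0 (maxBirkhoff θ f n (θ x))

theorem maxBirkhoff_mono (f : α → ℝ) (x : α) : Monotone fun n => maxBirkhoff θ f n x := by
  refine monotone_nat_of_le_succ fun n => ?_
  induction n generalizing x with
  | zero => simp [maxBirkhoff]
  | succ n ih =>
    have h := ih (θ x)
    simp only [maxBirkhoff] at h ⊢
    gcongr

theorem birkhoffSum_le_maxBirkhoff (f : α → ℝ) (n : ℕ) (x : α) :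
    birkhoffSum θ f (n + 1) x ≤ maxBirkhoff θ f n x := by
  induction n generalizing x with
  | zero => simp [maxBirkhoff]
  | succ n ih =>
    rw [birkhoffSum_succ', maxBirkhoff]
    gcongr
    exact (ih _).trans (le_max_right _ _)

/-- With $s_k=\sum_{i<k}u_i$, both sides are $s_{n+k}-s_n-s_k$. This turns a sum of $k$ increments
of lag $n$ into $n$ increments of lag $k$. -/
theorem sum_range_add_sub_comm (u : ℕ → ℝ) (k n : ℕ) :
    ∑ i ∈ Finset.range k, (u (n + i) - u i) = ∑ i ∈ Finset.range n, (u (k + i) - u i) := by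
  have h1 := Finset.sum_range_add u n k
  have h2 := Finset.sum_range_add u k n
  rw [add_comm k n, h1] at h2
  rw [Finset.sum_sub_distrib, Finset.sum_sub_distrib]
  linarith

/-- A sequence of reals that is additive up to a bounded error has a linear rate. -/
theorem exists_rate_of_almost_additive {e : ℕ → ℝ} {h : ℝ} (h0 : 0 ≤ h)
    (he : ∀ m n, |e (m + n) - e m - e n| ≤ h) :
    ∃ c : ℝ, ∀ n : ℕ, 1 ≤ n → |e n / n - c| ≤ h / n := by
  have hmul : ∀ n k : ℕ, |e ((k + 1) * n) - (k + 1 : ℕ) * e n| ≤ k * h := by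
    intro n k
    induction k with
    | zero => simp
    | succ k ih =>
      have := he ((k + 1) * n) n
      rw [← add_one_mul] at this
      rw [abs_le] at *
      push_cast at *
      constructor <;> linarith
  -- Both quotients are compared with $e_{nm}/(nm)$.
  have hdist : ∀ n m : ℕ, 1 ≤ n → 1 ≤ m → |e n / n - e m / m| ≤ h / n + h / m := by
    intro n m hn hm
    obtain ⟨a, rfl⟩ := Nat.exists_eq_add_of_le' hn
    obtain ⟨b, rfl⟩ := Nat.exists_eq_add_of_le' hm
    have h1 := hmul (a + 1) b
    have h2 := hmul (b + 1) a
    rw [mul_comm (b + 1) (a + 1)] at h1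
    have ha : (0 : ℝ) < (a + 1 : ℕ) := by positivity
    have hb : (0 : ℝ) < (b + 1 : ℕ) := by positivity
    have h3 : e (a + 1) / (a + 1 : ℕ) - e (b + 1) / (b + 1 : ℕ) =
        ((b + 1 : ℕ) * e (a + 1) - (a + 1 : ℕ) * e (b + 1)) / ((a + 1 : ℕ) * (b + 1 : ℕ)) := by
      field_simp
    have h4 : h / (a + 1 : ℕ) + h / (b + 1 : ℕ) =
        ((b + 1 : ℕ) * h + (a + 1 : ℕ) * h) / ((a + 1 : ℕ) * (b + 1 : ℕ)) := by
      field_simp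
    rw [h3, h4, abs_div, abs_of_pos (mul_pos ha hb)]
    gcongr
    rw [abs_le] at *
    push_cast at *
    constructor <;> linarith
  have hz : Tendsto (fun n : ℕ => h / n) atTop (𝓝 0) := tendsto_const_div_atTop_nhds_zero_nat h
  have hc : CauchySeq fun n : ℕ => e n / n := by
    rw [Metric.cauchySeq_iff]
    intro ε hε
    obtain ⟨N, hN⟩ := eventually_atTop.1
      ((hz.eventually (gt_mem_nhds (half_pos hε))).and (eventually_ge_atTop 1))
    refine ⟨N, fun m hm n hn => ?_⟩
    rw [Real.dist_eq]
    have := hdist m n (hN m hm).2 (hN n hn).2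
    linarith [(hN m hm).1, (hN n hn).1]
  obtain ⟨c, hc⟩ := cauchySeq_tendsto_of_complete hc
  refine ⟨c, fun n hn => ?_⟩
  have h1 : Tendsto (fun m : ℕ => |e n / n - e m / m|) atTop (𝓝 |e n / n - c|) :=
    (tendsto_const_nhds.sub hc).abs
  have h2 : Tendsto (fun m : ℕ => h / n + h / m) atTop (𝓝 (h / n + 0)) :=
    tendsto_const_nhds.add hz
  rw [add_zero] at h2
  refine le_of_tendsto_of_tendsto h1 h2 ?_
  filter_upwards [eventually_ge_atTop 1] with m hm using hdist n m hn hm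

/-- Up to $H(\theta^ix)$, $u_n(\theta^ix)$ is $u_{n+i}(x)-u_i(x)$. Summed over $i<k$, these
increments equal $n$ increments of lag $k$, each close to $u_k(x)$. The last two sums are boundary
terms, negligible against $k$ for fixed $n$. -/
theorem almost_additive_birkhoffSum_bound {u : ℕ → α → ℝ} {H : α → ℝ} {x : α}
    (hadd : ∀ m n, |u (m + n) x - u m x - u n (θ^[m] x)| ≤ H (θ^[m] x)) (n k : ℕ) :
    |n * u k x - birkhoffSum θ (u n) k x| ≤ birkhoffSum θ H k x +
      (∑ i ∈ Finset.range n, (|u i (θ^[k] x)| + H (θ^[k] x)) +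
        ∑ i ∈ Finset.range n, |u i x|) := by
  have h1 : |birkhoffSum θ (u n) k x - ∑ i ∈ Finset.range k, (u (n + i) x - u i x)| ≤
      birkhoffSum θ H k x := by
    rw [birkhoffSum, birkhoffSum, ← Finset.sum_sub_distrib]
    refine (Finset.abs_sum_le_sum_abs _ _).trans (Finset.sum_le_sum fun i _ => ?_)
    have := hadd i n
    rw [add_comm i n] at this
    rwa [abs_sub_comm]
  have h2 : |n * u k x - ∑ i ∈ Finset.range n, (u (k + i) x - u i x)| ≤
      ∑ i ∈ Finset.range n, (|u i (θ^[k] x)| + H (θ^[k] x)) +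
        ∑ i ∈ Finset.range n, |u i x| := by
    have : (n : ℝ) * u k x = ∑ i ∈ Finset.range n, u k x := by simp
    rw [this, ← Finset.sum_sub_distrib, ← Finset.sum_add_distrib]
    refine (Finset.abs_sum_le_sum_abs _ _).trans (Finset.sum_le_sum fun i _ => ?_)
    have h3 := abs_le.1 (hadd k i)
    have h4 := abs_le.1 (le_refl |u i x|)
    have h5 := abs_le.1 (le_refl |u i (θ^[k] x)|)
    rw [abs_le]
    constructor <;> linarith [h3.1, h3.2, h4.1, h4.2, h5.1, h5.2]
  rw [sum_range_add_sub_comm (fun i => u i x)] at h1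
  rw [abs_le] at *
  constructor <;> linarith [h1.1, h1.2, h2.1, h2.2]

variable [MeasurableSpace α] {μ : Measure α}

theorem measurable_maxBirkhoff (hθ : Measurable θ) {f : α → ℝ} (hf : Measurable f) (n : ℕ) :
    Measurable (maxBirkhoff θ f n) := by
  induction n with
  | zero => exact hf
  | succ n ih => exact hf.add (measurable_const.max (ih.comp hθ))

theorem integrable_maxBirkhoff [IsFiniteMeasure μ] (hθ : MeasurePreserving θ μ μ) {f : α → ℝ}
    (hf : Integrable f μ) (n : ℕ) : Integrable (maxBirkhoff θ f n) μ := by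
  induction n with
  | zero => exact hf
  | succ n ih =>
    exact hf.add ((integrable_const (0 : ℝ)).sup (hθ.integrable_comp_of_integrable ih))

theorem integral_comp_of_measurePreserving (hθ : MeasurePreserving θ μ μ) {f : α → ℝ}
    (hf : Measurable f) : ∫ x, f (θ x) ∂μ = ∫ x, f x ∂μ := by
  conv_rhs => rw [← hθ.map_eq]
  exact (integral_map hθ.measurable.aemeasurable hf.aestronglyMeasurable).symm

/-- The set where the maxima $M_n$ stay bounded is invariant, hence null or full. If it were null,
then $M_n\circ\theta\to\infty$ almost everywhere and
$M_{n+1}-M_n\circ\theta=f-\min(0,M_n\circ\theta)\to f$, dominated by $|f|+|f\circ\theta|$ since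
$M_n\ge f$. But this difference has integral $\int(M_{n+1}-M_n)\ge0$, against $\int f<0$. -/
theorem ae_bddAbove_maxBirkhoff [IsProbabilityMeasure μ] (hθ : Ergodic θ μ) {f : α → ℝ}
    (hfm : Measurable f) (hf : Integrable f μ) (hneg : ∫ x, f x ∂μ < 0) :
    ∀ᵐ x ∂μ, BddAbove (range fun n => maxBirkhoff θ f n x) := by
  have hM := fun n => measurable_maxBirkhoff hθ.measurable hfm n
  have hθ' := hθ.toMeasurePreserving
  set A : Set α := {x | BddAbove (range fun n => maxBirkhoff θ f n x)} with hA
  have hAm : MeasurableSet A := by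
    have : A = ⋃ N : ℕ, ⋂ n, {x | maxBirkhoff θ f n x ≤ N} := by
      ext x
      simp only [hA, mem_ofPred_eq, mem_iUnion, mem_iInter, bddAbove_def, forall_mem_range]
      constructor
      · rintro ⟨b, hb⟩
        obtain ⟨N, hN⟩ := exists_nat_ge b
        exact ⟨N, fun n => (hb n).trans hN⟩
      · rintro ⟨N, hN⟩
        exact ⟨N, hN⟩
    rw [this]
    exact MeasurableSet.iUnion fun N => MeasurableSet.iInter fun n =>
      measurableSet_le (hM n) measurable_const
  have hAinv : θ ⁻¹' A = A := by
    ext x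
    simp only [hA, mem_preimage, mem_ofPred_eq, bddAbove_def, forall_mem_range]
    constructor
    · rintro ⟨b, hb⟩
      refine ⟨f x + max 0 b, fun n => (maxBirkhoff_mono f x n.le_succ).trans ?_⟩
      simp only [maxBirkhoff]
      gcongr
      exact hb n
    · rintro ⟨b, hb⟩
      refine ⟨b - f x, fun n => ?_⟩
      have := hb (n + 1)
      simp only [maxBirkhoff] at this
      linarith [le_max_right 0 (maxBirkhoff θ f n (θ x))]
  rcases hθ.toPreErgodic.ae_mem_or_ae_notMem hAm hAinv with h | h
  · exact h
  exfalso
  have hlim : Tendsto (fun n => ∫ x, (maxBirkhoff θ f (n + 1) x - maxBirkhoff θ f n (θ x)) ∂μ)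
      atTop (𝓝 (∫ x, f x ∂μ)) := by
    refine tendsto_integral_of_dominated_convergence (fun x => |f x| + |f (θ x)|) ?_ ?_ ?_ ?_
    · exact fun n => ((hM _).sub ((hM n).comp hθ.measurable)).aestronglyMeasurable
    · exact hf.abs.add (hθ'.integrable_comp_of_integrable hf.abs)
    · refine fun n => Eventually.of_forall fun x => ?_
      have h1 : f (θ x) ≤ maxBirkhoff θ f n (θ x) := maxBirkhoff_mono f (θ x) (Nat.zero_le n)
      simp only [maxBirkhoff, Real.norm_eq_abs]
      rcases le_total 0 (maxBirkhoff θ f n (θ x)) with h0 | h0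
      · rw [max_eq_right h0]
        simp
      · rw [max_eq_left h0]
        refine (abs_sub _ _).trans ?_
        rw [add_zero, abs_of_nonpos h0, abs_of_nonpos (h1.trans h0)]
        linarith
    · filter_upwards [h] with x hx
      have hx' : ¬ BddAbove (range fun n => maxBirkhoff θ f n (θ x)) := by
        intro hb
        exact hx (by rw [← hAinv]; exact hb)
      have htop := tendsto_atTop_atTop_of_monotone' (maxBirkhoff_mono f (θ x)) hx'
      refine tendsto_const_nhds.congr' ?_
      filter_upwards [htop.eventually_ge_atTop 0] with n hn
      rw [maxBirkhoff, max_eq_right hn]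
      ring
  refine hneg.not_ge (ge_of_tendsto' hlim fun n => ?_)
  have hint : Integrable (fun x => maxBirkhoff θ f n (θ x)) μ :=
    hθ'.integrable_comp_of_integrable (integrable_maxBirkhoff hθ' hf _)
  rw [integral_sub (integrable_maxBirkhoff hθ' hf _) hint,
    integral_comp_of_measurePreserving hθ' (hM n), sub_nonneg]
  exact integral_mono (integrable_maxBirkhoff hθ' hf _) (integrable_maxBirkhoff hθ' hf _)
    fun x => maxBirkhoff_mono f x n.le_succ

/-- For $d$ strictly between $\int f$ and $c$, the Birkhoff sums of $f-d$ are bounded above by some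
$b$ depending on the point, so the averages of $f$ are at most $d+b/n$. -/
theorem ae_eventually_birkhoffAverage_le [IsProbabilityMeasure μ] (hθ : Ergodic θ μ) {f : α → ℝ}
    (hfm : Measurable f) (hf : Integrable f μ) {c : ℝ} (hc : ∫ x, f x ∂μ < c) :
    ∀ᵐ x ∂μ, ∀ᶠ n : ℕ in atTop, birkhoffSum θ f n x / n < c := by
  obtain ⟨d, hd, hdc⟩ := exists_between hc
  have hb := ae_bddAbove_maxBirkhoff hθ (f := fun x => f x - d) (hfm.sub_const d)
    (hf.sub (integrable_const d)) (by
      rw [integral_sub hf (integrable_const d)]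
      simpa using hd)
  filter_upwards [hb] with x hx
  obtain ⟨b, hb⟩ := bddAbove_def.1 hx
  simp only [forall_mem_range] at hb
  have h0 : Tendsto (fun n : ℕ => d + b / n) atTop (𝓝 (d + 0)) :=
    tendsto_const_nhds.add (tendsto_const_div_atTop_nhds_zero_nat b)
  rw [add_zero] at h0
  filter_upwards [h0.eventually (gt_mem_nhds hdc), eventually_ge_atTop 1] with n hn h1
  refine lt_of_le_of_lt ?_ hn
  obtain ⟨m, rfl⟩ := Nat.exists_eq_add_of_le' h1
  have h2 := (birkhoffSum_le_maxBirkhoff (θ := θ) (fun x => f x - d) m x).trans (hb m)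
  have h3 : birkhoffSum θ (fun x => f x - d) (m + 1) x =
      birkhoffSum θ f (m + 1) x - (m + 1 : ℕ) * d := by
    simp [birkhoffSum, Finset.sum_sub_distrib]
  have hpos : (0 : ℝ) < (m + 1 : ℕ) := by positivity
  rw [h3] at h2
  rw [div_le_iff₀ hpos, add_mul, div_mul_cancel₀ _ hpos.ne']
  linarith

/-- **Birkhoff's pointwise ergodic theorem** for ergodic transformations. -/
theorem ae_tendsto_birkhoffSum_div [IsProbabilityMeasure μ] (hθ : Ergodic θ μ) {f : α → ℝ}
    (hfm : Measurable f) (hf : Integrable f μ) :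
    ∀ᵐ x ∂μ, Tendsto (fun n : ℕ => birkhoffSum θ f n x / n) atTop (𝓝 (∫ x, f x ∂μ)) := by
  have hup : ∀ᵐ x ∂μ, ∀ i : ℕ, ∀ᶠ n : ℕ in atTop,
      birkhoffSum θ f n x / n < ∫ x, f x ∂μ + 1 / (i + 1 : ℝ) := by
    refine ae_all_iff.2 fun i => ae_eventually_birkhoffAverage_le hθ hfm hf ?_
    have : (0 : ℝ) < 1 / (i + 1 : ℝ) := by positivity
    linarith
  have hlo : ∀ᵐ x ∂μ, ∀ i : ℕ, ∀ᶠ n : ℕ in atTop,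
      birkhoffSum θ (fun x => -f x) n x / n < -∫ x, f x ∂μ + 1 / (i + 1 : ℝ) := by
    refine ae_all_iff.2 fun i => ae_eventually_birkhoffAverage_le hθ hfm.neg hf.neg ?_
    have : (0 : ℝ) < 1 / (i + 1 : ℝ) := by positivity
    simp only [Pi.neg_apply, integral_neg]
    linarith
  filter_upwards [hup, hlo] with x hx hx'
  rw [Metric.tendsto_atTop']
  intro ε hε
  obtain ⟨i, hi⟩ := exists_nat_one_div_lt hε
  obtain ⟨N, hN⟩ := eventually_atTop.1 ((hx i).and (hx' i))
  refine ⟨N, fun n hn => ?_⟩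
  obtain ⟨h1, h2⟩ := hN n hn.le
  have h3 : birkhoffSum θ (fun x => -f x) n x = -birkhoffSum θ f n x := by
    simp [birkhoffSum]
  rw [h3, neg_div] at h2
  rw [Real.dist_eq, abs_lt]
  constructor <;> linarith

/-- $f(\theta^nx)$ is the difference of two consecutive Birkhoff sums, whose averages have the same
limit. -/
theorem ae_tendsto_comp_iterate_div [IsProbabilityMeasure μ] (hθ : Ergodic θ μ) {f : α → ℝ}
    (hfm : Measurable f) (hf : Integrable f μ) :
    ∀ᵐ x ∂μ, Tendsto (fun n : ℕ => f (θ^[n] x) / n) atTop (𝓝 0) := by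
  filter_upwards [ae_tendsto_birkhoffSum_div hθ hfm hf] with x hx
  have h1 : Tendsto (fun n : ℕ => birkhoffSum θ f (n + 1) x / (n + 1 : ℕ) * ((n + 1 : ℕ) / n))
      atTop (𝓝 ((∫ x, f x ∂μ) * 1)) := by
    refine (hx.comp (tendsto_add_atTop_nat 1)).mul ?_
    have : Tendsto (fun n : ℕ => (1 : ℝ) + 1 / n) atTop (𝓝 (1 + 0)) :=
      tendsto_const_nhds.add (tendsto_const_div_atTop_nhds_zero_nat 1)
    rw [add_zero] at this
    refine this.congr' ?_
    filter_upwards [eventually_ge_atTop 1] with n hn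
    have : (n : ℝ) ≠ 0 := by positivity
    push_cast
    field_simp
  have h2 := h1.sub hx
  rw [mul_one, sub_self] at h2
  refine h2.congr' ?_
  filter_upwards [eventually_ge_atTop 1] with n hn
  have : (n : ℝ) ≠ 0 := by positivity
  have h3 : ((n + 1 : ℕ) : ℝ) ≠ 0 := by positivity
  rw [birkhoffSum_succ]
  field_simp
  ring

/-- A sequence of integrable functions that is additive along the orbits of an ergodic map, up to
an integrable error, grows linearly, almost surely and in mean. -/
theorem exists_rate_of_almost_additive_cocycle [IsProbabilityMeasure μ] (hθ : Ergodic θ μ)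
    {u : ℕ → α → ℝ} {H : α → ℝ} (hum : ∀ n, Measurable (u n)) (hu : ∀ n, Integrable (u n) μ)
    (hHm : Measurable H) (hH : Integrable H μ)
    (hadd : ∀ᵐ x ∂μ, ∀ m n, |u (m + n) x - u m x - u n (θ^[m] x)| ≤ H (θ^[m] x)) :
    ∃ c : ℝ, Tendsto (fun k : ℕ => (∫ x, u k x ∂μ) / k) atTop (𝓝 c) ∧
      ∀ᵐ x ∂μ, Tendsto (fun k : ℕ => u k x / k) atTop (𝓝 c) := by
  have hθ' := hθ.toMeasurePreserving
  set h := ∫ x, H x ∂μ with hh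
  have h0 : 0 ≤ h := by
    refine integral_nonneg_of_ae ?_
    filter_upwards [hadd] with x hx
    exact (abs_nonneg _).trans (hx 0 0)
  have hstep : ∀ m n, |(∫ x, u (m + n) x ∂μ) - ∫ x, u m x ∂μ - ∫ x, u n x ∂μ| ≤ h := by
    intro m n
    have hi : Integrable (fun x => u n (θ^[m] x)) μ :=
      (hθ'.iterate m).integrable_comp_of_integrable (hu n)
    have hiH : Integrable (fun x => H (θ^[m] x)) μ :=
      (hθ'.iterate m).integrable_comp_of_integrable hH
    have hi' : Integrable (fun x => u (m + n) x - u m x) μ := (hu _).sub (hu _)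
    rw [← integral_comp_of_measurePreserving (hθ'.iterate m) (hum n), hh,
      ← integral_comp_of_measurePreserving (hθ'.iterate m) hHm, ← integral_sub (hu _) (hu _),
      ← integral_sub hi' hi]
    refine abs_integral_le_integral_abs.trans (integral_mono_ae (hi'.sub hi).abs hiH ?_)
    filter_upwards [hadd] with x hx using hx m n
  obtain ⟨c, hc⟩ := exists_rate_of_almost_additive (e := fun n => ∫ x, u n x ∂μ) h0 hstep
  have hz : Tendsto (fun n : ℕ => h / n) atTop (𝓝 0) := tendsto_const_div_atTop_nhds_zero_nat h
  refine ⟨c, ?_, ?_⟩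
  · rw [tendsto_iff_dist_tendsto_zero]
    refine squeeze_zero' (Eventually.of_forall fun _ => dist_nonneg) ?_ hz
    filter_upwards [eventually_ge_atTop 1] with n hn
    rw [Real.dist_eq]
    exact hc n hn
  -- The boundary term at $\theta^kx$ in `almost_additive_birkhoffSum_bound`; it is integrable, so
  -- its value at $\theta^kx$ is $o(k)$.
  set B : ℕ → α → ℝ := fun n x => ∑ i ∈ Finset.range n, (|u i x| + H x) with hB
  have hBm : ∀ n, Measurable (B n) := fun n =>
    Finset.measurable_sum _ fun i _ => (hum i).abs.add hHm
  have hBi : ∀ n, Integrable (B n) μ := fun n =>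
    integrable_finsetSum _ fun i _ => (hu i).abs.add hH
  filter_upwards [hadd, ae_tendsto_birkhoffSum_div hθ hHm hH,
    ae_all_iff.2 fun n => ae_tendsto_birkhoffSum_div hθ (hum n) (hu n),
    ae_all_iff.2 fun n => ae_tendsto_comp_iterate_div hθ (hBm n) (hBi n)] with x hx hxH hxu hxB
  rw [Metric.tendsto_atTop']
  intro ε hε
  -- With $h/n<\varepsilon/2$, one $h/n$ pays for the Birkhoff average of $H$ and the other for
  -- replacing $n^{-1}\int u_n$ by $c$.
  obtain ⟨n, hn, hn1⟩ :=
    ((hz.eventually (gt_mem_nhds (half_pos hε))).and (eventually_ge_atTop 1)).exists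
  have hn0 : (0 : ℝ) < n := by exact_mod_cast hn1
  set b := ∑ i ∈ Finset.range n, |u i x|
  have hlim : Tendsto (fun k : ℕ => |birkhoffSum θ (u n) k x / k - ∫ x, u n x ∂μ| / n +
      (birkhoffSum θ H k x / k + (B n (θ^[k] x) / k + b / k)) / n + h / n) atTop
      (𝓝 (|(∫ x, u n x ∂μ) - ∫ x, u n x ∂μ| / n + (h + (0 + 0)) / n + h / n)) := by
    refine Tendsto.add (Tendsto.add ?_ ?_) tendsto_const_nhds
    · exact ((hxu n).sub_const _).abs.div_const _
    · exact (hxH.add ((hxB n).add (tendsto_const_div_atTop_nhds_zero_nat b))).div_const _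
  have hlt : |(∫ x, u n x ∂μ) - ∫ x, u n x ∂μ| / n + (h + (0 + 0)) / n + h / n < ε := by
    simp only [sub_self, abs_zero, zero_div, add_zero, zero_add]
    linarith
  obtain ⟨N, hN⟩ := eventually_atTop.1
    ((hlim.eventually (gt_mem_nhds hlt)).and (eventually_ge_atTop 1))
  refine ⟨N, fun k hk => ?_⟩
  obtain ⟨h1, h2⟩ := hN k hk.le
  refine lt_of_le_of_lt ?_ h1
  have hk0 : (0 : ℝ) < k := by exact_mod_cast h2
  have h3 := almost_additive_birkhoffSum_bound hx n k
  have h4 := hc n hn1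
  have h5 : |u k x / k - birkhoffSum θ (u n) k x / k / n| ≤
      (birkhoffSum θ H k x / k + (B n (θ^[k] x) / k + b / k)) / n := by
    have e1 : u k x / k - birkhoffSum θ (u n) k x / k / n =
        (n * u k x - birkhoffSum θ (u n) k x) / (n * k) := by
      field_simp
    have e2 : (birkhoffSum θ H k x / k + (B n (θ^[k] x) / k + b / k)) / n =
        (birkhoffSum θ H k x + (B n (θ^[k] x) + b)) / (n * k) := by
      field_simp
    rw [e1, e2, abs_div, abs_of_pos (mul_pos hn0 hk0)]
    gcongr
  have h6 : |birkhoffSum θ (u n) k x / k / n - (∫ x, u n x ∂μ) / n| =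
      |birkhoffSum θ (u n) k x / k - ∫ x, u n x ∂μ| / n := by
    rw [← sub_div, abs_div, abs_of_pos hn0]
  rw [Real.dist_eq]
  calc |u k x / k - c| ≤ |u k x / k - birkhoffSum θ (u n) k x / k / n| +
        |birkhoffSum θ (u n) k x / k / n - (∫ x, u n x ∂μ) / n| + |(∫ x, u n x ∂μ) / n - c| := by
        refine (abs_sub_le _ ((∫ x, u n x ∂μ) / n) _).trans ?_
        gcongr
        exact abs_sub_le _ _ _
    _ ≤ _ := by
        rw [h6]
        linarith

end ErgodicTheorem

/-! ### Cylinders in sequence space and a criterion for ergodicity of the shift. -/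

section PathSpace

variable {𝒵 : Type*}

/-- The shift on sequences. -/
def shift (z : ℕ → 𝒵) : ℕ → 𝒵 := fun i => z (i + 1)

theorem shift_iterate_apply (m : ℕ) (z : ℕ → 𝒵) (i : ℕ) : (shift^[m] z) i = z (i + m) := by
  induction m generalizing z with
  | zero => rfl
  | succ m ih =>
    rw [Function.iterate_succ_apply, ih, shift]
    congr 1

variable [MeasurableSpace 𝒵]

theorem measurable_shift : Measurable (shift : (ℕ → 𝒵) → ℕ → 𝒵) :=
  measurable_pi_lambda _ fun i => measurable_pi_apply (i + 1)

theorem measurable_pre (k : ℕ) : Measurable (pre k : (ℕ → 𝒵) → Fin k → 𝒵) :=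
  measurable_pi_lambda _ fun i => measurable_pi_apply (i : ℕ)

/-- The events that depend on finitely many coordinates. -/
def cylinders (𝒵 : Type*) [MeasurableSpace 𝒵] : Set (Set (ℕ → 𝒵)) :=
  {C | ∃ (k : ℕ) (A : Set (Fin k → 𝒵)), MeasurableSet A ∧ C = pre k ⁻¹' A}

theorem exists_cylinder_of_le {k n : ℕ} (h : k ≤ n) {A : Set (Fin k → 𝒵)} (hA : MeasurableSet A) :
    ∃ A' : Set (Fin n → 𝒵), MeasurableSet A' ∧ pre k ⁻¹' A = pre n ⁻¹' A' :=
  ⟨(fun z (i : Fin k) => z (Fin.castLE h i)) ⁻¹' A,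
    (measurable_pi_lambda _ fun _ => measurable_pi_apply _) hA, rfl⟩

theorem isSetRing_cylinders : IsSetRing (cylinders 𝒵) where
  empty_mem := ⟨0, ∅, .empty, rfl⟩
  union_mem := by
    rintro _ _ ⟨k, A, hA, rfl⟩ ⟨l, B, hB, rfl⟩
    obtain ⟨A', hA', e⟩ := exists_cylinder_of_le (le_max_left k l) hA
    obtain ⟨B', hB', e'⟩ := exists_cylinder_of_le (le_max_right k l) hB
    exact ⟨max k l, A' ∪ B', hA'.union hB', by rw [e, e', preimage_union]⟩
  sdiff_mem := by
    rintro _ _ ⟨k, A, hA, rfl⟩ ⟨l, B, hB, rfl⟩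
    obtain ⟨A', hA', e⟩ := exists_cylinder_of_le (le_max_left k l) hA
    obtain ⟨B', hB', e'⟩ := exists_cylinder_of_le (le_max_right k l) hB
    exact ⟨max k l, A' \ B', hA'.diff hB', by rw [e, e', preimage_sdiff]⟩

theorem generateFrom_cylinders :
    (inferInstance : MeasurableSpace (ℕ → 𝒵)) = MeasurableSpace.generateFrom (cylinders 𝒵) := by
  refine le_antisymm ?_ (MeasurableSpace.generateFrom_le ?_)
  · refine iSup_le fun i => ?_
    rintro _ ⟨s, hs, rfl⟩
    exact MeasurableSpace.measurableSet_generateFrom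
      ⟨i + 1, (fun z => z (Fin.last i)) ⁻¹' s, (measurable_pi_apply _) hs, rfl⟩
  · rintro _ ⟨k, A, hA, rfl⟩
    exact measurable_pre k hA

theorem ext_of_rectangles {k : ℕ} {μ μ' : Measure (Fin k → 𝒵)} [IsFiniteMeasure μ]
    (h : ∀ A : Fin k → Set 𝒵, (∀ i, MeasurableSet (A i)) → μ (univ.pi A) = μ' (univ.pi A)) :
    μ = μ' := by
  refine ext_of_generate_finite _ generateFrom_pi.symm isPiSystem_pi ?_
    (by simpa using h (fun _ => univ) fun _ => .univ)
  rintro _ ⟨A, hA, rfl⟩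
  exact h A fun i => hA i (mem_univ i)

theorem ext_of_map_pre {μ μ' : Measure (ℕ → 𝒵)} [IsProbabilityMeasure μ] [IsProbabilityMeasure μ']
    (h : ∀ k, μ.map (pre k) = μ'.map (pre k)) : μ = μ' := by
  refine ext_of_generate_finite _ generateFrom_cylinders
    isSetRing_cylinders.isSetSemiring.isPiSystem ?_ (by simp)
  rintro _ ⟨k, A, hA, rfl⟩
  rw [← Measure.map_apply (measurable_pre k) hA, h, Measure.map_apply (measurable_pre k) hA]

/-- A shift-invariant probability measure for which distant cylinders are not too negatively
correlated is ergodic. -/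
theorem ergodic_shift_of_cylinders {μ : Measure (ℕ → 𝒵)} [IsProbabilityMeasure μ]
    (hμ : MeasurePreserving shift μ μ) {ρ : (ℕ → 𝒵) → ℝ≥0∞} (hρ : Measurable ρ)
    (hρ0 : ∀ᵐ z ∂μ, ρ z ≠ 0) (hρ1 : ∀ z, ρ z ≤ 1) {r : ℕ}
    (h : ∀ n, r ≤ n → ∀ A B : Set (Fin n → 𝒵), MeasurableSet A → MeasurableSet B →
      μ (pre n ⁻¹' A) * ∫⁻ z in pre n ⁻¹' B, ρ z ∂μ ≤
        μ (pre n ⁻¹' A ∩ shift^[n] ⁻¹' (pre n ⁻¹' B))) :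
    Ergodic shift μ := by
  refine ⟨hμ, ⟨fun B hB hinv => ?_⟩⟩
  have hinv' : ∀ n, shift^[n] ⁻¹' B = B := fun n => by
    induction n with
    | zero => rfl
    | succ n ih => rw [Function.iterate_succ, preimage_comp, ih, hinv]
  -- Replace the invariant set $B$ by a cylinder $C$ at distance less than $\varepsilon$. The
  -- hypothesis applies to $C^c$ and $C$, and $C^c\cap\theta^{-n}C$ is small because
  -- $B^c\cap\theta^{-n}B$ is empty. Each of the four $\varepsilon$ is one such replacement.
  have key : ∀ ε : ℝ≥0∞, 0 < ε → μ Bᶜ * ∫⁻ z in B, ρ z ∂μ ≤ 4 * ε := by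
    intro ε hε
    obtain ⟨n, hn, A, hA, hC⟩ : ∃ n, r ≤ n ∧ ∃ A : Set (Fin n → 𝒵), MeasurableSet A ∧
        μ (symmDiff (pre n ⁻¹' A) B) < ε := by
      obtain ⟨C, ⟨k, A, hA, rfl⟩, hC⟩ :=
        exists_measure_symmDiff_lt_of_generateFrom_isSetRing (μ := μ) isSetRing_cylinders
          ⟨{univ}, countable_singleton _, by
            rw [singleton_subset_iff]; exact ⟨0, univ, .univ, rfl⟩, by simp⟩
          generateFrom_cylinders hB hε
      obtain ⟨A', hA', e⟩ := exists_cylinder_of_le (le_max_left k r) hA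
      exact ⟨max k r, le_max_right _ _, A', hA', e ▸ hC⟩
    set C : Set (ℕ → 𝒵) := pre n ⁻¹' A with hCdef
    have hCm : MeasurableSet C := measurable_pre n hA
    have hD : μ (symmDiff C B) ≤ ε := hC.le
    have hle : ∀ s : Set (ℕ → 𝒵), ∫⁻ z in s, ρ z ∂μ ≤ μ s := fun s =>
      (lintegral_mono hρ1).trans (by simp)
    have h1 : ∫⁻ z in B, ρ z ∂μ ≤ ∫⁻ z in C, ρ z ∂μ + ε := by
      have : B ⊆ C ∪ symmDiff C B := by
        intro z hz
        by_cases hzC : z ∈ C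
        · exact Or.inl hzC
        · exact Or.inr (Or.inr ⟨hz, hzC⟩)
      refine (lintegral_mono_set this).trans ((lintegral_union_le _ _ _).trans ?_)
      gcongr
      exact (hle _).trans hD
    have h2 : μ Bᶜ ≤ μ Cᶜ + ε := by
      have : Bᶜ ⊆ Cᶜ ∪ symmDiff C B := by
        intro z hz
        by_cases hzC : z ∈ C
        · exact Or.inr (Or.inl ⟨hzC, hz⟩)
        · exact Or.inl hzC
      exact (measure_mono this).trans ((measure_union_le _ _).trans (by gcongr))
    have h3 : μ (Cᶜ ∩ shift^[n] ⁻¹' C) ≤ ε + ε := by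
      have : Cᶜ ∩ shift^[n] ⁻¹' C ⊆ symmDiff C B ∪ shift^[n] ⁻¹' (symmDiff C B) := by
        rintro z ⟨hzC, hzn⟩
        by_cases hzB : z ∈ B
        · exact Or.inl (Or.inr ⟨hzB, hzC⟩)
        · refine Or.inr (Or.inl ⟨hzn, fun hz => hzB ?_⟩)
          rw [← hinv' n]
          exact hz
      refine (measure_mono this).trans ((measure_union_le _ _).trans ?_)
      rw [(hμ.iterate n).measure_preimage (hCm.symmDiff hB).nullMeasurableSet]
      gcongr
    calc μ Bᶜ * ∫⁻ z in B, ρ z ∂μ ≤ μ Bᶜ * (∫⁻ z in C, ρ z ∂μ + ε) := by gcongr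
      _ ≤ μ Bᶜ * ∫⁻ z in C, ρ z ∂μ + ε := by
        rw [mul_add]
        gcongr
        exact mul_le_of_le_one_left' prob_le_one
      _ ≤ (μ Cᶜ + ε) * ∫⁻ z in C, ρ z ∂μ + ε := by gcongr
      _ ≤ μ Cᶜ * ∫⁻ z in C, ρ z ∂μ + ε + ε := by
        rw [add_mul]
        gcongr
        exact mul_le_of_le_one_right' ((hle C).trans prob_le_one)
      _ ≤ ε + ε + ε + ε := by
        gcongr
        exact (h n hn Aᶜ A hA.compl hA).trans h3
      _ = 4 * ε := by ring
  have hzero : μ Bᶜ * ∫⁻ z in B, ρ z ∂μ = 0 := by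
    refine le_antisymm (ENNReal.le_of_forall_pos_le_add fun ε hε _ => ?_) zero_le
    refine (key (ε / 4) (by simpa using hε.ne')).trans ?_
    rw [zero_add, ENNReal.mul_div_cancel (by norm_num) (by norm_num)]
  rw [eventuallyConst_set]
  rcases mul_eq_zero.1 hzero with h0 | h0
  · exact Or.inl (ae_iff.2 h0)
  · right
    rw [lintegral_eq_zero_iff hρ, Filter.EventuallyEq, ae_restrict_iff' hB] at h0
    filter_upwards [h0, hρ0] with z h1 h2 h3
    exact h2 (h1 h3)

end PathSpace

/-! ### Matrix products, positivity of the chain, and near-multiplicativity of the likelihood ratio.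
-/

section Algebra

variable {S : Type*} [Fintype S] [DecidableEq S] {𝒵 : Type*} [MeasurableSpace 𝒵] {ν : Measure 𝒵}

/-- The likelihood ratio of a single measurement, given the state. -/
noncomputable def Model.ratio (M : Model S 𝒵 ν) (x : S) (z : 𝒵) : ℝ := M.f x z / M.f₀ z

theorem Model.ratio_nonneg (M : Model S 𝒵 ν) (x : S) (z : 𝒵) : 0 ≤ M.ratio x z :=
  div_nonneg (M.f_nonneg x z) (M.f₀_nonneg z)

theorem Model.measurable_ratio (M : Model S 𝒵 ν) (x : S) : Measurable (M.ratio x) :=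
  (M.f_measurable x).div M.f₀_measurable

theorem Model.trans_nonneg (M : Model S 𝒵 ν) (x y : S) : 0 ≤ M.trans x y :=
  Matrix.nonneg_of_mem_rowStochastic M.trans_mem

theorem Model.sum_trans (M : Model S 𝒵 ν) (x : S) : ∑ y, M.trans x y = 1 :=
  Matrix.sum_row_of_mem_rowStochastic M.trans_mem x

theorem Model.start_nonneg (M : Model S 𝒵 ν) (x : S) : 0 ≤ M.start x := M.start_mem.1 x

theorem Model.sum_start (M : Model S 𝒵 ν) : ∑ x, M.start x = 1 := M.start_mem.2

theorem Model.pow_trans_mem (M : Model S 𝒵 ν) (n : ℕ) : M.trans ^ n ∈ Matrix.rowStochastic ℝ S :=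
  pow_mem M.trans_mem n

theorem Model.pow_trans_nonneg (M : Model S 𝒵 ν) (n : ℕ) (x y : S) : 0 ≤ (M.trans ^ n) x y :=
  Matrix.nonneg_of_mem_rowStochastic (M.pow_trans_mem n)

theorem Model.pow_trans_pos_add (M : Model S 𝒵 ν) {m n : ℕ} {x y w : S}
    (h : 0 < (M.trans ^ m) x y) (h' : 0 < (M.trans ^ n) y w) : 0 < (M.trans ^ (m + n)) x w := by
  rw [pow_add, Matrix.mul_apply]
  exact (mul_pos h h').trans_le (Finset.single_le_sum (f := fun i => (M.trans ^ m) x i *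
    (M.trans ^ n) i w) (fun i _ => mul_nonneg (M.pow_trans_nonneg m x i)
      (M.pow_trans_nonneg n i w)) (Finset.mem_univ y))

theorem Model.exists_pow_trans_pos {M : Model S 𝒵 ν} (hM : M.Ergodic) (x y : S) :
    ∃ k : ℕ, 0 < (M.trans ^ k) x y := by
  obtain ⟨k, -, hk⟩ :=
    (Matrix.isIrreducible_iff_exists_pow_pos M.trans_nonneg).1 hM.irreducible x y
  exact ⟨k, hk⟩

/-- Some state has positive mass; stationarity under every power of the transition matrix and
irreducibility carry it to all others. -/
theorem Model.start_pos {M : Model S 𝒵 ν} (hM : M.Ergodic) (x : S) : 0 < M.start x := by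
  have hpow : ∀ n : ℕ, Matrix.vecMul M.start (M.trans ^ n) = M.start := fun n => by
    induction n with
    | zero => simp
    | succ n ih => rw [pow_succ, ← Matrix.vecMul_vecMul, ih, hM.stationary]
  obtain ⟨y, hy⟩ : ∃ y, 0 < M.start y := by
    by_contra! h
    have := Finset.sum_nonpos fun y (_ : y ∈ Finset.univ) => h y
    rw [M.sum_start] at this
    linarith
  obtain ⟨n, hn⟩ := M.exists_pow_trans_pos hM y x
  rw [← hpow n, Matrix.vecMul, dotProduct]
  exact (mul_pos hy hn).trans_le (Finset.single_le_sum (f := fun i => M.start i *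
    (M.trans ^ n) i x) (fun i _ => mul_nonneg (M.start_nonneg i)
      (M.pow_trans_nonneg n i x)) (Finset.mem_univ y))

/-- The possible return times form an additive submonoid of $\mathbb N$ with greatest common divisor
one, which contains all large integers. -/
theorem Model.exists_forall_return_pos {M : Model S 𝒵 ν} (hM : M.Ergodic) (x : S) :
    ∃ N : ℕ, ∀ n, N ≤ n → 0 < (M.trans ^ n) x x := by
  let T : AddSubmonoid ℕ :=
    { carrier := {n | 0 < (M.trans ^ n) x x}
      zero_mem' := by simp
      add_mem' := fun h h' => M.pow_trans_pos_add h h' }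
  obtain ⟨N, hN⟩ := Nat.exists_mem_closure_of_ge (T : Set ℕ)
  have hg : Nat.setGcd (T : Set ℕ) = 1 :=
    hM.aperiodic x _ fun n _ hn => Nat.setGcd_dvd_of_mem (s := (T : Set ℕ)) hn
  refine ⟨N, fun n hn => ?_⟩
  have := hN n hn (hg ▸ one_dvd n)
  rwa [AddSubmonoid.closure_eq] at this

/-- Some power of the transition matrix of an irreducible aperiodic chain has entries bounded away
from zero. -/
theorem Model.exists_pow_trans_ge {M : Model S 𝒵 ν} (hM : M.Ergodic) :
    ∃ (r : ℕ) (c : ℝ), 0 < c ∧ c ≤ 1 ∧ ∀ x y, c ≤ (M.trans ^ r) x y := by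
  choose N hN using M.exists_forall_return_pos hM
  choose k hk using M.exists_pow_trans_pos hM
  -- Large enough for every pair: return to $x$ after $r-k(x,y)\ge N(x)$ steps, then go to $y$ in
  -- $k(x,y)$ steps.
  set r := ∑ x, N x + ∑ p : S × S, k p.1 p.2 with hr
  have hpos : ∀ x y, 0 < (M.trans ^ r) x y := fun x y => by
    have h1 : N x ≤ ∑ x, N x := Finset.single_le_sum (fun _ _ => Nat.zero_le _) (Finset.mem_univ x)
    have h2 : k x y ≤ ∑ p : S × S, k p.1 p.2 :=
      Finset.single_le_sum (f := fun p : S × S => k p.1 p.2) (fun _ _ => Nat.zero_le _)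
        (Finset.mem_univ (x, y))
    have := M.pow_trans_pos_add (hN x (r - k x y) (by omega)) (hk x y)
    rwa [Nat.sub_add_cancel (by omega)] at this
  obtain ⟨x₀⟩ : Nonempty S := by
    by_contra h
    rw [not_nonempty_iff] at h
    simpa using M.sum_start
  obtain ⟨p, -, hp⟩ := Finset.exists_min_image (Finset.univ : Finset (S × S))
    (fun p => (M.trans ^ r) p.1 p.2) ⟨(x₀, x₀), Finset.mem_univ _⟩
  exact ⟨r, (M.trans ^ r) p.1 p.2, hpos _ _,
    Matrix.le_one_of_mem_rowStochastic (M.pow_trans_mem r),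
    fun x y => hp (x, y) (Finset.mem_univ _)⟩

/-- The matrix whose products give the likelihood ratios. -/
noncomputable def Model.step (M : Model S 𝒵 ν) (z : 𝒵) : Matrix S S ℝ :=
  fun x y => M.ratio x z * M.trans x y

/-- The product of the first `k` step matrices. -/
noncomputable def Model.prodStep (M : Model S 𝒵 ν) : ℕ → (ℕ → 𝒵) → Matrix S S ℝ
  | 0, _ => 1
  | k + 1, z => M.step (z 0) * M.prodStep k (shift z)

/-- The likelihood ratio of the first `k` measurements for the chain started from a given state. -/
noncomputable def Model.lrFrom (M : Model S 𝒵 ν) (k : ℕ) (z : ℕ → 𝒵) : S → ℝ :=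
  Matrix.mulVec (M.prodStep k z) 1

/-- The likelihood ratio of the first `k` measurements, as a function on sequences. -/
noncomputable def Model.pathLr (M : Model S 𝒵 ν) (k : ℕ) (z : ℕ → 𝒵) : ℝ := M.lr k (pre k z)

theorem Model.prodStep_add (M : Model S 𝒵 ν) (m n : ℕ) (z : ℕ → 𝒵) :
    M.prodStep (m + n) z = M.prodStep m z * M.prodStep n (shift^[m] z) := by
  induction m generalizing z with
  | zero => simp [Model.prodStep]
  | succ m ih =>
    rw [add_right_comm, Model.prodStep, ih, Model.prodStep, Matrix.mul_assoc,
      Function.iterate_succ_apply]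

theorem Model.lrFrom_add (M : Model S 𝒵 ν) (m n : ℕ) (z : ℕ → 𝒵) :
    M.lrFrom (m + n) z = Matrix.mulVec (M.prodStep m z) (M.lrFrom n (shift^[m] z)) := by
  rw [Model.lrFrom, M.prodStep_add, ← Matrix.mulVec_mulVec, Model.lrFrom]

theorem Model.lrFrom_zero (M : Model S 𝒵 ν) (z : ℕ → 𝒵) : M.lrFrom 0 z = 1 := by
  simp [Model.lrFrom, Model.prodStep]

theorem Model.lrFrom_succ (M : Model S 𝒵 ν) (k : ℕ) (z : ℕ → 𝒵) (x : S) :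
    M.lrFrom (k + 1) z x = M.ratio x (z 0) * ∑ y, M.trans x y * M.lrFrom k (shift z) y := by
  rw [Model.lrFrom, Model.prodStep, ← Matrix.mulVec_mulVec, Matrix.mulVec, dotProduct,
    Finset.mul_sum]
  simp only [Model.step, mul_assoc]
  rfl

/-- The initial weight `s` is arbitrary because the induction splits off the first state, after
which a row of the transition matrix takes the place of the initial distribution. -/
theorem Model.sum_traj (M : Model S 𝒵 ν) (k : ℕ) (s : S → ℝ) (z : ℕ → 𝒵) :
    ∑ x : Fin (k + 1) → S, s (x 0) * (∏ i : Fin k, M.trans (x i.castSucc) (x i.succ)) *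
      ∏ i, M.ratio (x i) (z i) = ∑ x, s x * M.lrFrom (k + 1) z x := by
  induction k generalizing s z with
  | zero =>
    rw [← (Equiv.funUnique (Fin 1) S).symm.sum_comp]
    refine Finset.sum_congr rfl fun x _ => ?_
    rw [M.lrFrom_succ, M.lrFrom_zero]
    simp [M.sum_trans]
  | succ k ih =>
    rw [← (Fin.consEquiv fun _ : Fin (k + 2) => S).sum_comp, Fintype.sum_prod_type]
    refine Finset.sum_congr rfl fun x _ => ?_
    rw [M.lrFrom_succ, ← ih, Finset.mul_sum, Finset.mul_sum]
    refine Finset.sum_congr rfl fun y _ => ?_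
    rw [Fin.prod_univ_succ, Fin.prod_univ_succ (n := k + 1)]
    simp [Fin.consEquiv, shift]
    ring

theorem Model.pathLr_eq_sum (M : Model S 𝒵 ν) (k : ℕ) (z : ℕ → 𝒵) :
    M.pathLr k z = ∑ x, M.start x * M.lrFrom k z x := by
  rw [Model.pathLr, Model.lr]
  cases k with
  | zero => simp [Model.trajProb, M.lrFrom_zero, M.sum_start]
  | succ k =>
    rw [← M.sum_traj]
    refine Finset.sum_congr rfl fun x _ => ?_
    rw [Model.trajProb, ← Finset.prod_div_distrib]
    rfl

/-- The joint likelihood of the first `k` measurements and the state that follows them. -/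
noncomputable def Model.fwd (M : Model S 𝒵 ν) (k : ℕ) (z : ℕ → 𝒵) : S → ℝ :=
  Matrix.vecMul M.start (M.prodStep k z)

theorem Model.pathLr_add (M : Model S 𝒵 ν) (m n : ℕ) (z : ℕ → 𝒵) :
    M.pathLr (m + n) z = ∑ y, M.fwd m z y * M.lrFrom n (shift^[m] z) y := by
  rw [M.pathLr_eq_sum]
  change M.start ⬝ᵥ M.lrFrom (m + n) z = M.fwd m z ⬝ᵥ M.lrFrom n (shift^[m] z)
  rw [M.lrFrom_add, Matrix.dotProduct_mulVec, Model.fwd]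

theorem Model.pathLr_eq_sum_fwd (M : Model S 𝒵 ν) (m : ℕ) (z : ℕ → 𝒵) :
    M.pathLr m z = ∑ y, M.fwd m z y := by
  simpa [M.lrFrom_zero] using M.pathLr_add m 0 z

theorem Model.prodStep_nonneg (M : Model S 𝒵 ν) (k : ℕ) (z : ℕ → 𝒵) (x y : S) :
    0 ≤ M.prodStep k z x y := by
  induction k generalizing z x with
  | zero =>
    rw [Model.prodStep, Matrix.one_apply]
    split_ifs <;> simp
  | succ k ih =>
    rw [Model.prodStep, Matrix.mul_apply]
    exact Finset.sum_nonneg fun w _ =>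
      mul_nonneg (mul_nonneg (M.ratio_nonneg _ _) (M.trans_nonneg _ _)) (ih _ _)

theorem Model.lrFrom_nonneg (M : Model S 𝒵 ν) (k : ℕ) (z : ℕ → 𝒵) (x : S) :
    0 ≤ M.lrFrom k z x := by
  rw [Model.lrFrom, Matrix.mulVec, dotProduct]
  exact Finset.sum_nonneg fun y _ => by simpa using M.prodStep_nonneg k z x y

theorem Model.fwd_nonneg (M : Model S 𝒵 ν) (k : ℕ) (z : ℕ → 𝒵) (x : S) : 0 ≤ M.fwd k z x := by
  rw [Model.fwd, Matrix.vecMul, dotProduct]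
  exact Finset.sum_nonneg fun y _ => mul_nonneg (M.start_nonneg y) (M.prodStep_nonneg k z y x)

theorem Model.pathLr_nonneg (M : Model S 𝒵 ν) (k : ℕ) (z : ℕ → 𝒵) : 0 ≤ M.pathLr k z := by
  rw [M.pathLr_eq_sum_fwd]
  exact Finset.sum_nonneg fun y _ => M.fwd_nonneg k z y

/-- The total absolute log-likelihood ratio of a measurement. -/
noncomputable def Model.absLog (M : Model S 𝒵 ν) (z : 𝒵) : ℝ := ∑ x, |Real.log (M.ratio x z)|

/-- The accumulated absolute log-likelihood ratio of the first `k` measurements. -/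
noncomputable def Model.cumAbsLog (M : Model S 𝒵 ν) (k : ℕ) (z : ℕ → 𝒵) : ℝ :=
  ∑ i ∈ Finset.range k, M.absLog (z i)

/-- All the likelihood ratios along the sequence are positive. -/
def Model.PosPath (M : Model S 𝒵 ν) (z : ℕ → 𝒵) : Prop := ∀ i x, 0 < M.ratio x (z i)

variable {M : Model S 𝒵 ν}

theorem Model.absLog_nonneg (z : 𝒵) : 0 ≤ M.absLog z := Finset.sum_nonneg fun _ _ => abs_nonneg _

theorem Model.cumAbsLog_nonneg (k : ℕ) (z : ℕ → 𝒵) : 0 ≤ M.cumAbsLog k z :=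
  Finset.sum_nonneg fun _ _ => M.absLog_nonneg _

theorem Model.cumAbsLog_mono {m n : ℕ} (h : m ≤ n) (z : ℕ → 𝒵) :
    M.cumAbsLog m z ≤ M.cumAbsLog n z :=
  Finset.sum_le_sum_of_subset_of_nonneg (Finset.range_mono h) fun _ _ _ => M.absLog_nonneg _

theorem Model.cumAbsLog_succ (k : ℕ) (z : ℕ → 𝒵) :
    M.cumAbsLog (k + 1) z = M.absLog (z 0) + M.cumAbsLog k (shift z) := by
  rw [Model.cumAbsLog, Finset.sum_range_succ', add_comm]
  rfl

theorem Model.abs_log_ratio_le (x : S) (z : 𝒵) : |Real.log (M.ratio x z)| ≤ M.absLog z :=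
  Finset.single_le_sum (f := fun x => |Real.log (M.ratio x z)|) (fun _ _ => abs_nonneg _)
    (Finset.mem_univ x)

theorem Model.ratio_le_exp {x : S} {z : 𝒵} (h : 0 < M.ratio x z) :
    M.ratio x z ≤ Real.exp (M.absLog z) := by
  rw [← Real.log_le_iff_le_exp h]
  exact (le_abs_self _).trans (M.abs_log_ratio_le x z)

theorem Model.exp_le_ratio {x : S} {z : 𝒵} (h : 0 < M.ratio x z) :
    Real.exp (-M.absLog z) ≤ M.ratio x z := by
  rw [← Real.le_log_iff_exp_le h]
  exact neg_le_of_abs_le (M.abs_log_ratio_le x z)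

theorem Model.PosPath.shift {z : ℕ → 𝒵} (h : M.PosPath z) : M.PosPath (shift z) :=
  fun i x => h (i + 1) x

theorem Model.PosPath.iterate {z : ℕ → 𝒵} (h : M.PosPath z) (m : ℕ) :
    M.PosPath (SeqHMM.shift^[m] z) := fun i x => by
  rw [shift_iterate_apply]
  exact h _ x

theorem Model.prodStep_le {z : ℕ → 𝒵} (h : M.PosPath z) (k : ℕ) (x y : S) :
    M.prodStep k z x y ≤ Real.exp (M.cumAbsLog k z) * (M.trans ^ k) x y := by
  induction k generalizing z x with
  | zero => simp [Model.prodStep, Model.cumAbsLog]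
  | succ k ih =>
    rw [Model.prodStep, pow_succ', Matrix.mul_apply, Matrix.mul_apply, Finset.mul_sum,
      M.cumAbsLog_succ, Real.exp_add]
    refine Finset.sum_le_sum fun w _ => ?_
    have h1 := M.ratio_le_exp (h 0 x)
    have h2 := ih h.shift w
    have h3 := M.trans_nonneg x w
    calc M.step (z 0) x w * M.prodStep k (SeqHMM.shift z) w y
        ≤ (Real.exp (M.absLog (z 0)) * M.trans x w) *
          (Real.exp (M.cumAbsLog k (SeqHMM.shift z)) * (M.trans ^ k) w y) := by
          rw [Model.step]
          gcongr
          exact M.prodStep_nonneg _ _ _ _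
      _ = _ := by ring

theorem Model.le_prodStep {z : ℕ → 𝒵} (h : M.PosPath z) (k : ℕ) (x y : S) :
    Real.exp (-M.cumAbsLog k z) * (M.trans ^ k) x y ≤ M.prodStep k z x y := by
  induction k generalizing z x with
  | zero => simp [Model.prodStep, Model.cumAbsLog]
  | succ k ih =>
    rw [Model.prodStep, pow_succ', Matrix.mul_apply, Matrix.mul_apply, Finset.mul_sum,
      M.cumAbsLog_succ, neg_add, Real.exp_add]
    refine Finset.sum_le_sum fun w _ => ?_
    have h1 := M.exp_le_ratio (h 0 x)
    have h2 := ih h.shift w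
    have h3 := M.trans_nonneg x w
    have h4 := M.pow_trans_nonneg k w y
    calc _ = (Real.exp (-M.absLog (z 0)) * M.trans x w) *
          (Real.exp (-M.cumAbsLog k (SeqHMM.shift z)) * (M.trans ^ k) w y) := by ring
      _ ≤ M.step (z 0) x w * M.prodStep k (SeqHMM.shift z) w y := by
          rw [Model.step]
          gcongr
          exact mul_nonneg (M.ratio_nonneg _ _) h3

theorem Model.lrFrom_le {z : ℕ → 𝒵} (h : M.PosPath z) (k : ℕ) (x : S) :
    M.lrFrom k z x ≤ Real.exp (M.cumAbsLog k z) := by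
  rw [Model.lrFrom, Matrix.mulVec, dotProduct]
  calc _ ≤ ∑ y, Real.exp (M.cumAbsLog k z) * (M.trans ^ k) x y :=
        Finset.sum_le_sum fun y _ => by simpa using M.prodStep_le h k x y
    _ = _ := by
        rw [← Finset.mul_sum, Matrix.sum_row_of_mem_rowStochastic (M.pow_trans_mem k), mul_one]

theorem Model.le_lrFrom {z : ℕ → 𝒵} (h : M.PosPath z) (k : ℕ) (x : S) :
    Real.exp (-M.cumAbsLog k z) ≤ M.lrFrom k z x := by
  rw [Model.lrFrom, Matrix.mulVec, dotProduct]
  calc _ = ∑ y, Real.exp (-M.cumAbsLog k z) * (M.trans ^ k) x y := by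
        rw [← Finset.mul_sum, Matrix.sum_row_of_mem_rowStochastic (M.pow_trans_mem k), mul_one]
    _ ≤ _ := Finset.sum_le_sum fun y _ => by simpa using M.le_prodStep h k x y

theorem Model.pathLr_le {z : ℕ → 𝒵} (h : M.PosPath z) (k : ℕ) :
    M.pathLr k z ≤ Real.exp (M.cumAbsLog k z) := by
  rw [M.pathLr_eq_sum]
  calc _ ≤ ∑ x, M.start x * Real.exp (M.cumAbsLog k z) :=
        Finset.sum_le_sum fun x _ => mul_le_mul_of_nonneg_left (M.lrFrom_le h k x)
          (M.start_nonneg x)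
    _ = _ := by rw [← Finset.sum_mul, M.sum_start, one_mul]

theorem Model.le_pathLr {z : ℕ → 𝒵} (h : M.PosPath z) (k : ℕ) :
    Real.exp (-M.cumAbsLog k z) ≤ M.pathLr k z := by
  rw [M.pathLr_eq_sum]
  calc _ = ∑ x, M.start x * Real.exp (-M.cumAbsLog k z) := by
        rw [← Finset.sum_mul, M.sum_start, one_mul]
    _ ≤ _ := Finset.sum_le_sum fun x _ => mul_le_mul_of_nonneg_left (M.le_lrFrom h k x)
          (M.start_nonneg x)

theorem Model.pathLr_pos {z : ℕ → 𝒵} (h : M.PosPath z) (k : ℕ) : 0 < M.pathLr k z :=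
  (Real.exp_pos _).trans_le (M.le_pathLr h k)

theorem Model.abs_log_pathLr_le {z : ℕ → 𝒵} (h : M.PosPath z) (k : ℕ) :
    |Real.log (M.pathLr k z)| ≤ M.cumAbsLog k z := by
  rw [abs_le]
  exact ⟨(Real.le_log_iff_exp_le (M.pathLr_pos h k)).2 (M.le_pathLr h k),
    (Real.log_le_iff_le_exp (M.pathLr_pos h k)).2 (M.pathLr_le h k)⟩

/-- The likelihood ratios of any number of measurements, started from two different states, differ
by a factor that depends on the first `r` measurements only. -/
theorem Model.lrFrom_le_mul_lrFrom {z : ℕ → 𝒵} (h : M.PosPath z) {r : ℕ} {c : ℝ} (hc : 0 < c)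
    (hc1 : c ≤ 1) (hr : ∀ x y, c ≤ (M.trans ^ r) x y) (n : ℕ) (x y : S) :
    M.lrFrom n z x ≤ Real.exp (2 * M.cumAbsLog r z) / c * M.lrFrom n z y := by
  have hE : Real.exp (2 * M.cumAbsLog r z) = Real.exp (M.cumAbsLog r z) *
      Real.exp (M.cumAbsLog r z) := by rw [two_mul, Real.exp_add]
  rw [div_mul_eq_mul_div, le_div_iff₀ hc]
  -- If $n\ge r$, all entries of the first $r$ factors lie between $e^{-L}c$ and $e^{L}$, whatever
  -- the initial state, and the remaining factors are common. If $n\le r$, the crude bounds $e^{\pm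
  -- L}$ suffice.
  rcases le_total r n with hn | hn
  · obtain ⟨m, rfl⟩ := Nat.exists_eq_add_of_le hn
    set b := M.lrFrom m (SeqHMM.shift^[r] z) with hb
    have hb0 : 0 ≤ ∑ w, b w := Finset.sum_nonneg fun w _ => M.lrFrom_nonneg _ _ _
    have h1 : M.lrFrom (r + m) z x ≤ Real.exp (M.cumAbsLog r z) * ∑ w, b w := by
      rw [M.lrFrom_add, Matrix.mulVec, dotProduct, Finset.mul_sum]
      refine Finset.sum_le_sum fun w _ => mul_le_mul_of_nonneg_right ?_ (M.lrFrom_nonneg _ _ _)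
      refine (M.prodStep_le h r x w).trans (mul_le_of_le_one_right (Real.exp_pos _).le ?_)
      exact Matrix.le_one_of_mem_rowStochastic (M.pow_trans_mem r)
    have h2 : Real.exp (-M.cumAbsLog r z) * c * ∑ w, b w ≤ M.lrFrom (r + m) z y := by
      rw [M.lrFrom_add, Matrix.mulVec, dotProduct, Finset.mul_sum]
      refine Finset.sum_le_sum fun w _ => mul_le_mul_of_nonneg_right ?_ (M.lrFrom_nonneg _ _ _)
      refine le_trans ?_ (M.le_prodStep h r y w)
      gcongr
      exact hr y w
    calc M.lrFrom (r + m) z x * c ≤ (Real.exp (M.cumAbsLog r z) * ∑ w, b w) * c := by gcongr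
      _ = Real.exp (2 * M.cumAbsLog r z) * (Real.exp (-M.cumAbsLog r z) * c * ∑ w, b w) := by
        rw [hE, Real.exp_neg]
        have := (Real.exp_pos (M.cumAbsLog r z)).ne'
        field_simp
      _ ≤ _ := by gcongr
  · have hL := M.cumAbsLog_mono hn z
    have h1 : M.lrFrom n z x ≤ Real.exp (M.cumAbsLog r z) :=
      (M.lrFrom_le h n x).trans (Real.exp_le_exp.2 hL)
    have h2 : Real.exp (-M.cumAbsLog r z) ≤ M.lrFrom n z y :=
      (Real.exp_le_exp.2 (neg_le_neg hL)).trans (M.le_lrFrom h n y)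
    calc M.lrFrom n z x * c ≤ Real.exp (M.cumAbsLog r z) * 1 := by
          gcongr
      _ = Real.exp (2 * M.cumAbsLog r z) * Real.exp (-M.cumAbsLog r z) := by
        rw [← Real.exp_add]; ring_nf
      _ ≤ _ := by gcongr

/-- The factor up to which the likelihood ratio is multiplicative. -/
noncomputable def Model.distortion (M : Model S 𝒵 ν) (r : ℕ) (c : ℝ) (z : ℕ → 𝒵) : ℝ :=
  Real.exp (2 * M.cumAbsLog r z) / c

/-- After time $m$ the likelihood is averaged over the state reached, with weights `fwd`. Replacing
each of these states by an average over the initial distribution costs one distortion factor. -/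
theorem Model.pathLr_add_le {z : ℕ → 𝒵} (h : M.PosPath z) {r : ℕ} {c : ℝ} (hc : 0 < c)
    (hc1 : c ≤ 1) (hr : ∀ x y, c ≤ (M.trans ^ r) x y) (m n : ℕ) :
    M.pathLr (m + n) z ≤
      M.distortion r c (SeqHMM.shift^[m] z) * (M.pathLr m z * M.pathLr n (SeqHMM.shift^[m] z)) := by
  have h' := h.iterate m
  have h1 : ∀ y, M.lrFrom n (SeqHMM.shift^[m] z) y ≤
      M.distortion r c (SeqHMM.shift^[m] z) * M.pathLr n (SeqHMM.shift^[m] z) := fun y => by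
    rw [M.pathLr_eq_sum, Finset.mul_sum]
    calc _ = ∑ x, M.start x * M.lrFrom n (SeqHMM.shift^[m] z) y := by
          rw [← Finset.sum_mul, M.sum_start, one_mul]
      _ ≤ _ := Finset.sum_le_sum fun x _ => by
          rw [mul_left_comm]
          exact mul_le_mul_of_nonneg_left (M.lrFrom_le_mul_lrFrom h' hc hc1 hr n y x)
            (M.start_nonneg x)
  rw [M.pathLr_add, M.pathLr_eq_sum_fwd m, mul_left_comm, Finset.sum_mul]
  exact Finset.sum_le_sum fun y _ => mul_le_mul_of_nonneg_left (h1 y) (M.fwd_nonneg _ _ _)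

/-- The same comparison in the other direction; besides the growth rates, it also yields ergodicity
when the signal is present. -/
theorem Model.pathLr_mul_le {z : ℕ → 𝒵} (h : M.PosPath z) {r : ℕ} {c : ℝ} (hc : 0 < c)
    (hc1 : c ≤ 1) (hr : ∀ x y, c ≤ (M.trans ^ r) x y) (m n : ℕ) :
    M.pathLr m z * M.pathLr n (SeqHMM.shift^[m] z) ≤
      M.distortion r c (SeqHMM.shift^[m] z) * M.pathLr (m + n) z := by
  have h' := h.iterate m
  have h1 : ∀ y, M.pathLr n (SeqHMM.shift^[m] z) ≤
      M.distortion r c (SeqHMM.shift^[m] z) * M.lrFrom n (SeqHMM.shift^[m] z) y := fun y => by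
    rw [M.pathLr_eq_sum]
    calc _ ≤ ∑ x, M.start x * (M.distortion r c (SeqHMM.shift^[m] z) *
          M.lrFrom n (SeqHMM.shift^[m] z) y) := Finset.sum_le_sum fun x _ =>
            mul_le_mul_of_nonneg_left (M.lrFrom_le_mul_lrFrom h' hc hc1 hr n x y)
            (M.start_nonneg x)
      _ = _ := by rw [← Finset.sum_mul, M.sum_start, one_mul]
  rw [M.pathLr_add, M.pathLr_eq_sum_fwd m, Finset.sum_mul, Finset.mul_sum]
  refine Finset.sum_le_sum fun y _ => ?_
  rw [mul_left_comm]
  exact mul_le_mul_of_nonneg_left (h1 y) (M.fwd_nonneg _ _ _)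

theorem Model.log_distortion {r : ℕ} {c : ℝ} (hc : 0 < c) (z : ℕ → 𝒵) :
    Real.log (M.distortion r c z) = 2 * M.cumAbsLog r z - Real.log c := by
  rw [Model.distortion, Real.log_div (Real.exp_pos _).ne' hc.ne', Real.log_exp]

theorem Model.abs_log_pathLr_add_sub_le {z : ℕ → 𝒵} (h : M.PosPath z) {r : ℕ} {c : ℝ} (hc : 0 < c)
    (hc1 : c ≤ 1) (hr : ∀ x y, c ≤ (M.trans ^ r) x y) (m n : ℕ) :
    |Real.log (M.pathLr (m + n) z) - Real.log (M.pathLr m z) -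
      Real.log (M.pathLr n (SeqHMM.shift^[m] z))| ≤
        2 * M.cumAbsLog r (SeqHMM.shift^[m] z) - Real.log c := by
  have p1 := M.pathLr_pos h (m + n)
  have p2 := M.pathLr_pos h m
  have p3 := M.pathLr_pos (h.iterate m) n
  have pD : 0 < M.distortion r c (SeqHMM.shift^[m] z) := div_pos (Real.exp_pos _) hc
  have h1 := Real.log_le_log p1 (M.pathLr_add_le h hc hc1 hr m n)
  have h2 := Real.log_le_log (mul_pos p2 p3) (M.pathLr_mul_le h hc hc1 hr m n)
  rw [Real.log_mul pD.ne' (mul_pos p2 p3).ne', Real.log_mul p2.ne' p3.ne',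
    M.log_distortion hc] at h1
  rw [Real.log_mul pD.ne' p1.ne', Real.log_mul p2.ne' p3.ne', M.log_distortion hc] at h2
  rw [abs_le]
  constructor <;> linarith

end Algebra

/-! ### Laws of the measurements: change of measure, invariance and ergodicity. -/

section Laws

variable {S : Type*} [Fintype S] [DecidableEq S] {𝒵 : Type*} [MeasurableSpace 𝒵] {ν : Measure 𝒵}
  {M : Model S 𝒵 ν} {Ω : Type*} [MeasurableSpace Ω] {P₀ P₁ : Measure Ω}
  {X : ℕ → Ω → S} {Z : ℕ → Ω → 𝒵}

/-- The sequence of measurements. -/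
def path (Z : ℕ → Ω → 𝒵) (ω : Ω) : ℕ → 𝒵 := fun i => Z i ω

theorem measurable_path (hZ : ∀ i, Measurable (Z i)) : Measurable (path Z) :=
  measurable_pi_lambda _ hZ

/-- The distribution of a single measurement under noise only. -/
noncomputable def Model.noise (M : Model S 𝒵 ν) : Measure 𝒵 :=
  ν.withDensity fun z => ENNReal.ofReal (M.f₀ z)

instance (M : Model S 𝒵 ν) : IsProbabilityMeasure M.noise :=
  ⟨by rw [Model.noise, withDensity_apply _ .univ, Measure.restrict_univ, M.f₀_lintegral]⟩

theorem Model.IsNoise.map_comp_eq [IsProbabilityMeasure P₀] (h : M.IsNoise P₀ Z) {k : ℕ}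
    {g : Fin k → ℕ} (hg : g.Injective) :
    P₀.map (fun ω i => Z (g i) ω) = Measure.pi fun _ => M.noise := by
  have h1 : iIndepFun (fun i ω => Z (g i) ω) P₀ := h.indep.precomp hg
  rw [iIndepFun_iff_map_fun_eq_pi_map fun i => (h.measurable (g i)).aemeasurable] at h1
  rw [h1]
  congr 1
  funext i
  exact h.law (g i)

theorem Model.IsNoise.measurePreserving_shift [IsProbabilityMeasure P₀] (h : M.IsNoise P₀ Z) :
    MeasurePreserving shift (P₀.map (path Z)) (P₀.map (path Z)) := by
  have hp := measurable_path h.measurable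
  refine ⟨measurable_shift, ?_⟩
  have := Measure.isProbabilityMeasure_map (μ := P₀) hp.aemeasurable
  have := Measure.isProbabilityMeasure_map (μ := P₀.map (path Z))
    measurable_shift.aemeasurable
  refine ext_of_map_pre fun k => ?_
  rw [Measure.map_map (measurable_pre k) measurable_shift,
    Measure.map_map ((measurable_pre k).comp measurable_shift) hp,
    Measure.map_map (measurable_pre k) hp]
  exact (h.map_comp_eq (g := fun i : Fin k => (i : ℕ) + 1)
    fun i j hij => Fin.ext (by simpa using hij)).trans
      (h.map_comp_eq (g := fun i : Fin k => (i : ℕ)) Fin.val_injective).symm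

omit [MeasurableSpace 𝒵] [MeasurableSpace Ω] in
theorem iterate_shift_path (m : ℕ) (ω : Ω) : shift^[m] (path Z ω) = fun i => Z (i + m) ω := by
  funext i
  rw [shift_iterate_apply, path]

theorem Model.IsNoise.indepFun_pre_iterate_shift (h : M.IsNoise P₀ Z) (m : ℕ) :
    IndepFun (fun ω => pre m (path Z ω)) (fun ω => shift^[m] (path Z ω)) P₀ := by
  have h1 := indep_iSup_of_disjoint (fun i => (h.measurable i).comap_le) h.indep
    (S := {i | i < m}) (T := {i | m ≤ i})
    (disjoint_left.2 fun i (hi : i < m) (hi' : m ≤ i) => absurd hi (not_lt.2 hi'))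
  rw [IndepFun_iff_Indep]
  refine indep_of_indep_of_le_left (indep_of_indep_of_le_right h1 ?_) ?_
  · simp_rw [iterate_shift_path]
    rw [MeasurableSpace.pi, MeasurableSpace.comap_iSup]
    refine iSup_le fun i => ?_
    rw [MeasurableSpace.comap_comp]
    exact le_iSup₂_of_le (f := fun i (_ : i ∈ {i | m ≤ i}) =>
      MeasurableSpace.comap (Z i) inferInstance) (i + m) (Nat.le_add_left m i) le_rfl
  · rw [MeasurableSpace.pi, MeasurableSpace.comap_iSup]
    refine iSup_le fun i => ?_
    rw [MeasurableSpace.comap_comp]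
    exact le_iSup₂_of_le (f := fun i (_ : i ∈ {i | i < m}) =>
      MeasurableSpace.comap (Z i) inferInstance) (i : ℕ) i.2 le_rfl

/-- Under noise only the past is independent of the future, which is distributed as the whole. -/
theorem Model.IsNoise.lintegral_mul [IsProbabilityMeasure P₀] (h : M.IsNoise P₀ Z) (m : ℕ)
    {F : (Fin m → 𝒵) → ℝ≥0∞} (hF : Measurable F) {G : (ℕ → 𝒵) → ℝ≥0∞} (hG : Measurable G) :
    ∫⁻ z, F (pre m z) * G (shift^[m] z) ∂(P₀.map (path Z)) =
      (∫⁻ z, F (pre m z) ∂(P₀.map (path Z))) * ∫⁻ z, G z ∂(P₀.map (path Z)) := by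
  have hp := measurable_path h.measurable
  have hs : Measurable (shift^[m] : (ℕ → 𝒵) → ℕ → 𝒵) := measurable_shift.iterate m
  have hFm : Measurable fun z => F (pre m z) := hF.comp (measurable_pre m)
  have hGm : Measurable fun z => G (shift^[m] z) := hG.comp hs
  conv_rhs => rw [← (h.measurePreserving_shift.iterate m).lintegral_comp hG]
  rw [lintegral_map (f := fun z => F (pre m z) * G (shift^[m] z)) (hFm.mul hGm) hp,
    lintegral_map hFm hp, lintegral_map hGm hp]
  exact lintegral_mul_eq_lintegral_mul_lintegral_of_indepFun (hFm.comp hp) (hGm.comp hp)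
    ((h.indepFun_pre_iterate_shift m).comp hF hG)

theorem Model.trajProb_nonneg (M : Model S 𝒵 ν) (k : ℕ) (x : Fin k → S) : 0 ≤ M.trajProb k x := by
  cases k with
  | zero => simp [Model.trajProb]
  | succ k =>
    exact mul_nonneg (M.start_nonneg _) (Finset.prod_nonneg fun _ _ => M.trans_nonneg _ _)

theorem Model.sum_trajProb_cons (hM : Matrix.vecMul M.start M.trans = M.start) (k : ℕ)
    (x : Fin k → S) : ∑ y, M.trajProb (k + 1) (Fin.cons y x : Fin (k + 1) → S) =
      M.trajProb k x := by
  cases k with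
  | zero => simp [Model.trajProb, M.sum_start]
  | succ k =>
    have h1 : ∑ y, M.start y * M.trans y (x 0) = M.start (x 0) := congrFun hM (x 0)
    simp only [Model.trajProb]
    rw [← h1, Finset.sum_mul]
    refine Finset.sum_congr rfl fun y _ => ?_
    rw [Fin.prod_univ_succ]
    simp [mul_assoc]

/-- Finite-dimensional distributions of the measurements when the signal is present. -/
theorem Model.IsSignal.measure_rectangle (h : M.IsSignal P₁ X Z) (k : ℕ) {A : Fin k → Set 𝒵}
    (hA : ∀ i, MeasurableSet (A i)) :
    P₁ {ω | ∀ i : Fin k, Z i ω ∈ A i} = ∑ x : Fin k → S, ENNReal.ofReal (M.trajProb k x) *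
      ∏ i, ∫⁻ z in A i, ENNReal.ofReal (M.f (x i) z) ∂ν := by
  have h1 : {ω | ∀ i : Fin k, Z i ω ∈ A i} =
      ⋃ x ∈ (Finset.univ : Finset (Fin k → S)),
        {ω | ∀ i : Fin k, X i ω = x i ∧ Z i ω ∈ A i} := by
    ext ω
    simp only [mem_ofPred_eq, mem_iUnion, Finset.mem_univ, exists_true_left]
    exact ⟨fun hω => ⟨fun i => X i ω, fun i => ⟨rfl, hω i⟩⟩, fun ⟨x, hx⟩ i => (hx i).2⟩
  rw [h1, measure_biUnion_finset]
  · exact Finset.sum_congr rfl fun x _ => h.law k x A hA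
  · intro x _ y _ hxy
    refine disjoint_left.2 fun ω hx hy => hxy (funext fun i => ?_)
    rw [← (hx i).1, ← (hy i).1]
  · intro x _
    simp only [ofPred_forall, ofPred_and]
    exact MeasurableSet.iInter fun i =>
      (h.measurable_state i (x i)).inter (h.measurable i (hA i))

theorem Model.IsSignal.map_pre_apply (h : M.IsSignal P₁ X Z) {k : ℕ} {A : Fin k → Set 𝒵}
    (hA : ∀ i, MeasurableSet (A i)) :
    P₁.map (fun ω => pre k (path Z ω)) (univ.pi A) =
      ∑ x : Fin k → S, ENNReal.ofReal (M.trajProb k x) *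
      ∏ i, ∫⁻ z in A i, ENNReal.ofReal (M.f (x i) z) ∂ν := by
  have hp : Measurable fun ω => pre k (path Z ω) :=
    (measurable_pre k).comp (measurable_path h.measurable)
  rw [← h.measure_rectangle k hA, Measure.map_apply hp (MeasurableSet.univ_pi hA)]
  congr 1
  ext ω
  simp [pre, path]

/-- A rectangle for the shifted sequence is one with an unconstrained measurement in front; its
density integrates to one and its state is summed out by stationarity. -/
theorem Model.IsSignal.measurePreserving_shift [IsProbabilityMeasure P₁] (h : M.IsSignal P₁ X Z)
    (hM : Matrix.vecMul M.start M.trans = M.start) :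
    MeasurePreserving shift (P₁.map (path Z)) (P₁.map (path Z)) := by
  have hp := measurable_path h.measurable
  refine ⟨measurable_shift, ?_⟩
  have := Measure.isProbabilityMeasure_map (μ := P₁) hp.aemeasurable
  have := Measure.isProbabilityMeasure_map (μ := P₁.map (path Z))
    measurable_shift.aemeasurable
  refine ext_of_map_pre fun k => ?_
  rw [Measure.map_map (measurable_pre k) measurable_shift,
    Measure.map_map ((measurable_pre k).comp measurable_shift) hp,
    Measure.map_map (measurable_pre k) hp]
  have := Measure.isProbabilityMeasure_map (μ := P₁)
    (((measurable_pre k).comp measurable_shift).comp hp).aemeasurable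
  refine ext_of_rectangles fun A hA => ?_
  refine Eq.trans ?_ (h.map_pre_apply hA).symm
  rw [Measure.map_apply (((measurable_pre k).comp measurable_shift).comp hp)
    (MeasurableSet.univ_pi hA)]
  have h1 : (pre k ∘ shift) ∘ path Z ⁻¹' univ.pi A =
      {ω | ∀ i : Fin (k + 1), Z i ω ∈ (Fin.cons univ A : Fin (k + 1) → Set 𝒵) i} := by
    ext ω
    simp [Fin.forall_fin_succ, pre, shift, path]
  have h2 : ∀ i, MeasurableSet ((Fin.cons univ A : Fin (k + 1) → Set 𝒵) i) := fun i => by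
    refine Fin.cases ?_ (fun i => ?_) i
    · exact MeasurableSet.univ
    · exact hA i
  rw [h1, h.measure_rectangle (k + 1) h2,
    ← (Fin.consEquiv fun _ : Fin (k + 1) => S).sum_comp, Fintype.sum_prod_type_right]
  refine Finset.sum_congr rfl fun x _ => ?_
  rw [← M.sum_trajProb_cons hM, ENNReal.ofReal_sum_of_nonneg fun _ _ => M.trajProb_nonneg _ _,
    Finset.sum_mul]
  refine Finset.sum_congr rfl fun y _ => ?_
  rw [Fin.prod_univ_succ]
  simp [Fin.consEquiv, M.f_lintegral]

/-- The first measurement has density $\sum_x\pi(x)f(\cdot|x)$ with all weights positive, so its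
null sets are null for each component. Applied to $\{f_0\le0\}$, this gives absolute continuity with
respect to the noise law. -/
theorem Model.IsSignal.lintegral_f_eq_zero (h : M.IsSignal P₁ X Z) (hM : M.Ergodic)
    {A : Set 𝒵} (hA : MeasurableSet A) (h0 : ∀ᵐ ω ∂P₁, Z 0 ω ∉ A) (x : S) :
    ∫⁻ z in A, ENNReal.ofReal (M.f x z) ∂ν = 0 := by
  have h1 := h.measure_rectangle 1 (A := fun _ => A) fun _ => hA
  have h2 : P₁ {ω | ∀ i : Fin 1, Z i ω ∈ A} = 0 := by
    rw [ae_iff] at h0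
    simpa using h0
  rw [h2, eq_comm, Finset.sum_eq_zero_iff] at h1
  have h3 := h1 (fun _ => x) (Finset.mem_univ _)
  simpa [Model.trajProb, (M.start_pos hM x).not_ge] using h3

theorem Model.IsSignal.lintegral_ratio (h : M.IsSignal P₁ X Z) (hM : M.Ergodic)
    (hlog : M.FiniteLogMoment P₁ Z) {A : Set 𝒵} (hA : MeasurableSet A) (x : S) :
    ∫⁻ z in A, ENNReal.ofReal (M.ratio x z) ∂M.noise =
      ∫⁻ z in A, ENNReal.ofReal (M.f x z) ∂ν := by
  have hN : MeasurableSet {z | M.f₀ z ≤ 0} := measurableSet_le M.f₀_measurable measurable_const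
  have h0 := h.lintegral_f_eq_zero hM hN
    (by filter_upwards [(hlog x).1] with ω hω hω'; exact absurd hω.2 (not_lt.2 hω')) x
  rw [lintegral_eq_zero_iff (M.f_measurable x).ennreal_ofReal, Filter.EventuallyEq,
    ae_restrict_iff' hN] at h0
  rw [Model.noise, restrict_withDensity hA,
    lintegral_withDensity_eq_lintegral_mul _ M.f₀_measurable.ennreal_ofReal
      (M.measurable_ratio x).ennreal_ofReal]
  refine lintegral_congr_ae (ae_restrict_of_ae ?_)
  filter_upwards [h0] with z hz
  rw [Pi.mul_apply, ← ENNReal.ofReal_mul (M.f₀_nonneg z), Model.ratio]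
  -- Where $f_0=0$ the quotient is $0$ by convention; this does no harm, as $f(\cdot|x)$ vanishes
  -- there too.
  rcases (M.f₀_nonneg z).eq_or_lt with h1 | h1
  · rw [hz h1.symm.le, ← h1]
    simp
  · rw [mul_div_cancel₀ _ h1.ne']

theorem Model.lr_eq_sum_prod (M : Model S 𝒵 ν) (k : ℕ) (z : Fin k → 𝒵) :
    M.lr k z = ∑ x : Fin k → S, M.trajProb k x * ∏ i, M.ratio (x i) (z i) := by
  rw [Model.lr]
  refine Finset.sum_congr rfl fun x _ => ?_
  rw [← Finset.prod_div_distrib]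
  rfl

/-- For each trajectory the integrand is a product of functions of single measurements, so under
noise the integral factorises by independence. Agreement on rectangles is what identifies
$\Lambda_k$ as a density. -/
theorem Model.setLIntegral_lr [IsProbabilityMeasure P₀] (h₀ : M.IsNoise P₀ Z)
    (h₁ : M.IsSignal P₁ X Z) (hM : M.Ergodic) (hlog : M.FiniteLogMoment P₁ Z) {k : ℕ}
    {A : Fin k → Set 𝒵} (hA : ∀ i, MeasurableSet (A i)) :
    ∫⁻ ω in {ω | ∀ i : Fin k, Z i ω ∈ A i}, ENNReal.ofReal (M.lr k (pre k (path Z ω))) ∂P₀ =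
      ∑ x : Fin k → S, ENNReal.ofReal (M.trajProb k x) *
        ∏ i, ∫⁻ z in A i, ENNReal.ofReal (M.f (x i) z) ∂ν := by
  have hR : MeasurableSet {ω | ∀ i : Fin k, Z i ω ∈ A i} := by
    rw [ofPred_forall]
    exact MeasurableSet.iInter fun i => h₀.measurable i (hA i)
  set g : S → Set 𝒵 → 𝒵 → ℝ≥0∞ := fun x B => B.indicator fun z => ENNReal.ofReal (M.ratio x z)
  have hg : ∀ x B, MeasurableSet B → Measurable (g x B) := fun x B hB =>
    (M.measurable_ratio x).ennreal_ofReal.indicator hB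
  have h1 : ∀ ω, {ω | ∀ i : Fin k, Z i ω ∈ A i}.indicator
      (fun ω => ENNReal.ofReal (M.lr k (pre k (path Z ω)))) ω =
      ∑ x : Fin k → S, ENNReal.ofReal (M.trajProb k x) * ∏ i : Fin k, g (x i) (A i) (Z i ω) := by
    intro ω
    by_cases hω : ∀ i : Fin k, Z i ω ∈ A i
    · rw [indicator_of_mem (by exact hω), M.lr_eq_sum_prod, ENNReal.ofReal_sum_of_nonneg
        fun x _ => mul_nonneg (M.trajProb_nonneg k x)
          (Finset.prod_nonneg fun _ _ => M.ratio_nonneg _ _)]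
      refine Finset.sum_congr rfl fun x _ => ?_
      rw [ENNReal.ofReal_mul (M.trajProb_nonneg k x),
        ENNReal.ofReal_prod_of_nonneg fun _ _ => M.ratio_nonneg _ _]
      congr 1
      refine Finset.prod_congr rfl fun i _ => ?_
      simp only [g]
      rw [indicator_of_mem (hω i)]
      rfl
    · rw [indicator_of_notMem (by exact hω), eq_comm]
      push Not at hω
      obtain ⟨i, hi⟩ := hω
      refine Finset.sum_eq_zero fun x _ => ?_
      rw [Finset.prod_eq_zero (Finset.mem_univ i), mul_zero]
      simp only [g]
      rw [indicator_of_notMem hi]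
  have hgZ : ∀ (x : Fin k → S) (i : Fin k), Measurable fun ω => g (x i) (A i) (Z i ω) :=
    fun x i => (hg _ _ (hA i)).comp (h₀.measurable i)
  rw [← lintegral_indicator hR]
  simp_rw [h1]
  rw [lintegral_finsetSum _ fun x _ =>
    (Finset.measurable_prod _ fun i _ => hgZ x i).const_mul _]
  refine Finset.sum_congr rfl fun x _ => ?_
  rw [lintegral_const_mul _ (Finset.measurable_prod _ fun i _ => hgZ x i)]
  congr 1
  have hind : iIndepFun (fun (i : Fin k) ω => g (x i) (A i) (Z i ω)) P₀ :=
    (h₀.indep.precomp Fin.val_injective).comp (fun i => g (x i) (A i)) fun i => hg _ _ (hA i)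
  rw [lintegral_prod_eq_prod_lintegral_of_indepFun _ _ hind (hgZ x)]
  refine Finset.prod_congr rfl fun i _ => ?_
  rw [← h₁.lintegral_ratio hM hlog (hA i), ← lintegral_indicator (hA i), Model.noise,
    ← h₀.law i, lintegral_map (hg _ _ (hA i)) (h₀.measurable i)]

/-- Change of measure: `Λ_k` is the density of the law of the first `k` measurements when the
signal is present with respect to their law under noise only. -/
theorem Model.map_pre_signal [IsProbabilityMeasure P₀] [IsProbabilityMeasure P₁]
    (h₀ : M.IsNoise P₀ Z) (h₁ : M.IsSignal P₁ X Z) (hM : M.Ergodic)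
    (hlog : M.FiniteLogMoment P₁ Z) (k : ℕ) :
    P₁.map (fun ω => pre k (path Z ω)) = (P₀.map fun ω => pre k (path Z ω)).withDensity
      fun z => ENNReal.ofReal (M.lr k z) := by
  have hp : Measurable fun ω => pre k (path Z ω) :=
    (measurable_pre k).comp (measurable_path h₁.measurable)
  have := Measure.isProbabilityMeasure_map (μ := P₁) hp.aemeasurable
  refine ext_of_rectangles fun A hA => ?_
  rw [h₁.map_pre_apply hA, withDensity_apply _ (MeasurableSet.univ_pi hA),
    setLIntegral_map (MeasurableSet.univ_pi hA) (M.measurable_lr k).ennreal_ofReal hp,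
    ← M.setLIntegral_lr h₀ h₁ hM hlog hA]
  congr 2
  ext ω
  simp [pre, path]

theorem Model.measurable_pathLr (M : Model S 𝒵 ν) (k : ℕ) : Measurable (M.pathLr k) :=
  (M.measurable_lr k).comp (measurable_pre k)

theorem Model.lintegral_signal [IsProbabilityMeasure P₀] [IsProbabilityMeasure P₁]
    (h₀ : M.IsNoise P₀ Z) (h₁ : M.IsSignal P₁ X Z) (hM : M.Ergodic)
    (hlog : M.FiniteLogMoment P₁ Z) {k : ℕ} {F : (Fin k → 𝒵) → ℝ≥0∞} (hF : Measurable F) :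
    ∫⁻ z, F (pre k z) ∂(P₁.map (path Z)) =
      ∫⁻ z, ENNReal.ofReal (M.pathLr k z) * F (pre k z) ∂(P₀.map (path Z)) := by
  have hp := measurable_path h₁.measurable
  have hk := measurable_pre (𝒵 := 𝒵) k
  have h1 := M.map_pre_signal h₀ h₁ hM hlog k
  have hl := (M.measurable_lr k).ennreal_ofReal
  have hFk : Measurable fun z => F (pre k z) := hF.comp hk
  rw [lintegral_map hFk hp, lintegral_map
    (f := fun z => ENNReal.ofReal (M.pathLr k z) * F (pre k z))
    ((M.measurable_pathLr k).ennreal_ofReal.mul hFk) hp]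
  have h2 := lintegral_map (μ := P₁) hF (hk.comp hp)
  have h3 := lintegral_map (μ := P₀) (hl.mul hF) (hk.comp hp)
  refine h2.symm.trans (Eq.trans ?_ h3)
  change ∫⁻ a, F a ∂(P₁.map fun ω => pre k (path Z ω)) = _
  rw [h1, lintegral_withDensity_eq_lintegral_mul _ hl hF]
  rfl

theorem Model.ae_posPath {μ : Measure (ℕ → 𝒵)} (hμ : MeasurePreserving shift μ μ)
    (h : ∀ᵐ z ∂μ, ∀ x, 0 < M.ratio x (z 0)) : ∀ᵐ z ∂μ, M.PosPath z := by
  have : ∀ᵐ z ∂μ, ∀ i x, 0 < M.ratio x ((shift^[i] z) 0) :=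
    ae_all_iff.2 fun i => (hμ.iterate i).quasiMeasurePreserving.ae h
  filter_upwards [this] with z hz i x
  have := hz i x
  rwa [shift_iterate_apply, zero_add] at this

theorem Model.FiniteLogMoment.ae_posPath {P : Measure Ω} (hZ : ∀ i, Measurable (Z i))
    (hlog : M.FiniteLogMoment P Z)
    (hμ : MeasurePreserving shift (P.map (path Z)) (P.map (path Z))) :
    ∀ᵐ z ∂(P.map (path Z)), M.PosPath z := by
  refine M.ae_posPath hμ ((ae_map_iff (measurable_path hZ).aemeasurable ?_).2 ?_)
  · rw [ofPred_forall]
    exact MeasurableSet.iInter fun x => measurableSet_lt measurable_const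
      ((M.measurable_ratio x).comp (measurable_pi_apply 0))
  · filter_upwards [ae_all_iff.2 fun x => (hlog x).1] with ω hω x
    exact div_pos (hω x).1 (hω x).2

theorem Model.measurable_absLog (M : Model S 𝒵 ν) : Measurable M.absLog :=
  Finset.measurable_sum _ fun x _ => (M.measurable_ratio x).log.abs

theorem Model.measurable_cumAbsLog (M : Model S 𝒵 ν) (k : ℕ) : Measurable (M.cumAbsLog k) :=
  Finset.measurable_sum _ fun i _ => M.measurable_absLog.comp (measurable_pi_apply i)

theorem Model.integrable_cumAbsLog {P : Measure Ω} (hZ : ∀ i, Measurable (Z i))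
    (hlog : M.FiniteLogMoment P Z)
    (hμ : MeasurePreserving shift (P.map (path Z)) (P.map (path Z))) (k : ℕ) :
    Integrable (M.cumAbsLog k) (P.map (path Z)) := by
  have h0 : Integrable (fun z : ℕ → 𝒵 => M.absLog (z 0)) (P.map (path Z)) := by
    refine (integrable_map_measure (M.measurable_absLog.comp
      (measurable_pi_apply 0)).aestronglyMeasurable (measurable_path hZ).aemeasurable).2 ?_
    exact integrable_finsetSum _ fun x _ => (hlog x).2.abs
  refine integrable_finsetSum _ fun i _ => ?_
  have := (hμ.iterate i).integrable_comp_of_integrable h0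
  simpa [Function.comp_def, shift_iterate_apply] using this

theorem Model.IsNoise.ergodic_shift [IsProbabilityMeasure P₀] (h : M.IsNoise P₀ Z) :
    _root_.Ergodic shift (P₀.map (path Z)) := by
  have hp := measurable_path h.measurable
  have := Measure.isProbabilityMeasure_map (μ := P₀) hp.aemeasurable
  refine ergodic_shift_of_cylinders h.measurePreserving_shift (ρ := 1) (r := 0)
    measurable_const (by simp) (by simp) fun n _ A B hA hB => ?_
  have hB' := measurable_pre n hB
  have h1 := h.lintegral_mul n (F := A.indicator 1) (measurable_one.indicator hA)
    (G := (pre n ⁻¹' B).indicator 1) (measurable_one.indicator hB')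
  rw [lintegral_indicator_one hB'] at h1
  have h2 : ∀ z : ℕ → 𝒵, A.indicator (1 : (Fin n → 𝒵) → ℝ≥0∞) (pre n z) =
      (pre n ⁻¹' A).indicator 1 z := fun z => rfl
  have h3 : ∀ z : ℕ → 𝒵, (pre n ⁻¹' A).indicator (1 : (ℕ → 𝒵) → ℝ≥0∞) z *
      (pre n ⁻¹' B).indicator 1 (shift^[n] z) =
        (pre n ⁻¹' A ∩ shift^[n] ⁻¹' (pre n ⁻¹' B)).indicator 1 z := fun z => by
    rw [inter_indicator_one]
    rfl
  simp_rw [h2, h3] at h1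
  rw [lintegral_indicator_one (measurable_pre n hA), lintegral_indicator_one
    ((measurable_pre n hA).inter ((measurable_shift.iterate n) hB'))] at h1
  rw [h1]
  simp

/-- All probabilities are transferred to the noise law, where past and future are independent; the
correlation bound with $\rho=1/D$ then reduces to the pointwise inequality `Model.pathLr_mul_le`. -/
theorem Model.IsSignal.ergodic_shift [IsProbabilityMeasure P₀] [IsProbabilityMeasure P₁]
    (h₀ : M.IsNoise P₀ Z) (h₁ : M.IsSignal P₁ X Z) (hM : M.Ergodic)
    (hlog₀ : M.FiniteLogMoment P₀ Z) (hlog₁ : M.FiniteLogMoment P₁ Z) :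
    _root_.Ergodic shift (P₁.map (path Z)) := by
  have hp := measurable_path h₁.measurable
  have := Measure.isProbabilityMeasure_map (μ := P₁) hp.aemeasurable
  obtain ⟨r, c, hc, hc1, hr⟩ := M.exists_pow_trans_ge hM
  have hDpos : ∀ z : ℕ → 𝒵, 0 < M.distortion r c z := fun z => div_pos (Real.exp_pos _) hc
  have hD1 : ∀ z : ℕ → 𝒵, 1 ≤ M.distortion r c z := fun z => by
    rw [Model.distortion, le_div_iff₀ hc, one_mul]
    refine hc1.trans (Real.one_le_exp ?_)
    have := M.cumAbsLog_nonneg r z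
    positivity
  have hDm : Measurable (M.distortion r c) :=
    (((M.measurable_cumAbsLog r).const_mul 2).exp).div_const c
  refine ergodic_shift_of_cylinders (h₁.measurePreserving_shift hM.stationary)
    (ρ := fun z => ENNReal.ofReal (M.distortion r c z)⁻¹) (r := r) hDm.inv.ennreal_ofReal
    (Eventually.of_forall fun z => by simpa using hDpos z)
    (fun z => by
      rw [← ENNReal.ofReal_one]
      exact ENNReal.ofReal_le_ofReal (inv_le_one_of_one_le₀ (hD1 z))) fun n hn A B hA hB => ?_
  have hA' := measurable_pre n hA
  have hB' := measurable_pre n hB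
  have hAB := hA'.inter ((measurable_shift.iterate n) hB')
  -- The distortion reads only the first $r\le n$ measurements, so it is subject to the change of
  -- measure at time $n$.
  set D' : (Fin n → 𝒵) → ℝ := fun z =>
    Real.exp (2 * ∑ i : Fin r, M.absLog (z (Fin.castLE hn i))) / c
  have hD' : ∀ z, M.distortion r c z = D' (pre n z) := fun z => by
    rw [Model.distortion, Model.cumAbsLog, ← Fin.sum_univ_eq_sum_range (fun i => M.absLog (z i))]
    rfl
  have hD'm : Measurable D' := by
    refine (Measurable.exp (Measurable.const_mul
      (Finset.measurable_sum _ fun i _ => ?_) 2)).div_const c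
    exact M.measurable_absLog.comp (measurable_pi_apply _)
  have e1 : P₁.map (path Z) (pre n ⁻¹' A) = ∫⁻ z, ENNReal.ofReal (M.lr n (pre n z)) *
      A.indicator 1 (pre n z) ∂(P₀.map (path Z)) := by
    rw [← lintegral_indicator_one hA']
    exact M.lintegral_signal h₀ h₁ hM hlog₁ (F := A.indicator 1) (measurable_one.indicator hA)
  have e2 : ∫⁻ z in pre n ⁻¹' B, ENNReal.ofReal (M.distortion r c z)⁻¹ ∂(P₁.map (path Z)) =
      ∫⁻ z, ENNReal.ofReal (M.pathLr n z) * (pre n ⁻¹' B).indicator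
        (fun z => ENNReal.ofReal (M.distortion r c z)⁻¹) z ∂(P₀.map (path Z)) := by
    rw [← lintegral_indicator hB']
    have := M.lintegral_signal h₀ h₁ hM hlog₁
      (F := B.indicator fun z => ENNReal.ofReal (D' z)⁻¹) (hD'm.inv.ennreal_ofReal.indicator hB)
    have e : ∀ z, B.indicator (fun z => ENNReal.ofReal (D' z)⁻¹) (pre n z) =
        (pre n ⁻¹' B).indicator (fun z => ENNReal.ofReal (M.distortion r c z)⁻¹) z := fun z => by
      simp only [indicator, hD']
      rfl
    simpa only [e] using this
  have e3 : P₁.map (path Z) (pre n ⁻¹' A ∩ shift^[n] ⁻¹' (pre n ⁻¹' B)) =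
      ∫⁻ z, ENNReal.ofReal (M.pathLr (n + n) z) *
        (pre n ⁻¹' A ∩ shift^[n] ⁻¹' (pre n ⁻¹' B)).indicator 1 z ∂(P₀.map (path Z)) := by
    rw [← lintegral_indicator_one hAB]
    set E : Set (Fin (n + n) → 𝒵) := {z | (fun i => z (Fin.castAdd n i)) ∈ A} ∩
      {z | (fun i => z (Fin.natAdd n i)) ∈ B}
    have hE : MeasurableSet E :=
      ((measurable_pi_lambda _ fun i => measurable_pi_apply _) hA).inter
        ((measurable_pi_lambda _ fun i => measurable_pi_apply _) hB)
    have hpre : pre n ⁻¹' A ∩ shift^[n] ⁻¹' (pre n ⁻¹' B) = pre (n + n) ⁻¹' E := by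
      ext z
      have : pre n (shift^[n] z) = fun i : Fin n => pre (n + n) z (Fin.natAdd n i) := by
        funext i
        simp [pre, shift_iterate_apply, add_comm]
      simp only [mem_inter_iff, mem_preimage, this]
      rfl
    rw [hpre]
    exact M.lintegral_signal h₀ h₁ hM hlog₁ (F := E.indicator 1) (measurable_one.indicator hE)
  rw [e1, e2, e3, ← h₀.lintegral_mul n
    (F := fun z => ENNReal.ofReal (M.lr n z) * A.indicator 1 z)
    (G := fun z => ENNReal.ofReal (M.pathLr n z) * (pre n ⁻¹' B).indicator
        (fun z => ENNReal.ofReal (M.distortion r c z)⁻¹) z)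
    (((M.measurable_lr n).ennreal_ofReal).mul (measurable_one.indicator hA))
    (((M.measurable_pathLr n).ennreal_ofReal).mul (hDm.inv.ennreal_ofReal.indicator hB'))]
  refine lintegral_mono_ae ?_
  filter_upwards [hlog₀.ae_posPath h₀.measurable h₀.measurePreserving_shift] with z hz
  by_cases hzA : pre n z ∈ A
  swap
  · rw [indicator_of_notMem hzA]
    simp
  by_cases hzB : shift^[n] z ∈ pre n ⁻¹' B
  swap
  · rw [indicator_of_notMem hzB]
    simp
  have hzAB : z ∈ pre n ⁻¹' A ∩ shift^[n] ⁻¹' (pre n ⁻¹' B) := ⟨hzA, hzB⟩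
  rw [indicator_of_mem hzA, indicator_of_mem hzB, indicator_of_mem hzAB]
  have hD := hDpos (shift^[n] z)
  simp only [Pi.one_apply, mul_one]
  change ENNReal.ofReal (M.pathLr n z) * _ ≤ _
  rw [← ENNReal.ofReal_mul (M.pathLr_nonneg _ _), ← ENNReal.ofReal_mul (M.pathLr_nonneg n z)]
  refine ENNReal.ofReal_le_ofReal ?_
  rw [← mul_assoc, ← div_eq_mul_inv, div_le_iff₀ hD, mul_comm (M.pathLr (n + n) z)]
  exact M.pathLr_mul_le hz hc hc1 hr n n

end Laws

/-! ### Existence and signs of the growth rates. -/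

section Rates

variable {S : Type*} [Fintype S] [DecidableEq S] {𝒵 : Type*} [MeasurableSpace 𝒵] {ν : Measure 𝒵}
  {M : Model S 𝒵 ν} {Ω : Type*} [MeasurableSpace Ω] {P P₀ P₁ : Measure Ω}
  {X : ℕ → Ω → S} {Z : ℕ → Ω → 𝒵}

theorem Model.integrable_log_pathLr (hZ : ∀ i, Measurable (Z i)) (hlog : M.FiniteLogMoment P Z)
    (hμ : MeasurePreserving shift (P.map (path Z)) (P.map (path Z))) (k : ℕ) :
    Integrable (fun z => Real.log (M.pathLr k z)) (P.map (path Z)) := by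
  refine (M.integrable_cumAbsLog hZ hlog hμ k).mono'
    (M.measurable_pathLr k).log.aestronglyMeasurable ?_
  filter_upwards [hlog.ae_posPath hZ hμ] with z hz using M.abs_log_pathLr_le hz k

/-- The log-likelihood ratio grows linearly, almost surely and in mean. -/
theorem Model.exists_isLogRate [IsProbabilityMeasure P] (hM : M.Ergodic)
    (hZ : ∀ i, Measurable (Z i)) (hlog : M.FiniteLogMoment P Z)
    (hμ : _root_.Ergodic shift (P.map (path Z))) :
    ∃ c, M.IsLogRate P Z c ∧
      ∀ᵐ ω ∂P, Tendsto (fun k : ℕ => Real.log (M.pathLr k (path Z ω)) / k) atTop (𝓝 c) := by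
  have hp := measurable_path hZ
  have := Measure.isProbabilityMeasure_map (μ := P) hp.aemeasurable
  obtain ⟨r, c, hc, hc1, hr⟩ := M.exists_pow_trans_ge hM
  have hμ' := hμ.toMeasurePreserving
  have hm := fun k => (M.measurable_pathLr k).log
  have hi := M.integrable_log_pathLr hZ hlog hμ'
  obtain ⟨l, hl, hl'⟩ := exists_rate_of_almost_additive_cocycle hμ
    (u := fun k z => Real.log (M.pathLr k z)) (H := fun z => 2 * M.cumAbsLog r z - Real.log c) hm
    hi (((M.measurable_cumAbsLog r).const_mul 2).sub_const _)
    (((M.integrable_cumAbsLog hZ hlog hμ' r).const_mul 2).sub (integrable_const _))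
    (by filter_upwards [hlog.ae_posPath hZ hμ'] with z hz using
          M.abs_log_pathLr_add_sub_le hz hc hc1 hr)
  refine ⟨l, ⟨fun k => ?_, ?_⟩, ae_of_ae_map hp.aemeasurable hl'⟩
  · exact (integrable_map_measure (hm k).aestronglyMeasurable hp.aemeasurable).1 (hi k)
  · refine hl.congr fun k => ?_
    rw [integral_map hp.aemeasurable (hm k).aestronglyMeasurable, div_eq_inv_mul]
    rfl

theorem Model.IsSignal.lintegral_ratio_eq_one (h : M.IsSignal P₁ X Z) (hM : M.Ergodic)
    (hlog : M.FiniteLogMoment P₁ Z) (x : S) :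
    ∫⁻ z, ENNReal.ofReal (M.ratio x z) ∂M.noise = 1 := by
  have := h.lintegral_ratio hM hlog .univ x
  rwa [Measure.restrict_univ, Measure.restrict_univ, M.f_lintegral] at this

theorem Model.IsSignal.integrable_ratio (h : M.IsSignal P₁ X Z) (hM : M.Ergodic)
    (hlog : M.FiniteLogMoment P₁ Z) (x : S) : Integrable (M.ratio x) M.noise := by
  refine ⟨(M.measurable_ratio x).aestronglyMeasurable, ?_⟩
  rw [hasFiniteIntegral_iff_ofReal (Eventually.of_forall (M.ratio_nonneg x)),
    h.lintegral_ratio_eq_one hM hlog x]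
  exact ENNReal.one_lt_top

theorem Model.IsSignal.integral_ratio (h : M.IsSignal P₁ X Z) (hM : M.Ergodic)
    (hlog : M.FiniteLogMoment P₁ Z) (x : S) : ∫ z, M.ratio x z ∂M.noise = 1 := by
  rw [integral_eq_lintegral_of_nonneg_ae (Eventually.of_forall (M.ratio_nonneg x))
    (M.measurable_ratio x).aestronglyMeasurable, h.lintegral_ratio_eq_one hM hlog x]
  simp

theorem sqrt_le_one_add {a : ℝ} (ha : 0 ≤ a) : √a ≤ 1 + a := by
  rw [Real.sqrt_le_iff]
  constructor <;> nlinarith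

theorem Model.measurable_sum_ratio (M : Model S 𝒵 ν) (c : S → ℝ) :
    Measurable fun z => ∑ x, c x * M.ratio x z :=
  Finset.measurable_sum _ fun x _ => (M.measurable_ratio x).const_mul _

theorem Model.IsSignal.integrable_sum_ratio (h : M.IsSignal P₁ X Z) (hM : M.Ergodic)
    (hlog : M.FiniteLogMoment P₁ Z) (c : S → ℝ) :
    Integrable (fun z => ∑ x, c x * M.ratio x z) M.noise :=
  integrable_finsetSum _ fun x _ => (h.integrable_ratio hM hlog x).const_mul _

theorem Model.IsSignal.integrable_sqrt (h : M.IsSignal P₁ X Z) (hM : M.Ergodic)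
    (hlog : M.FiniteLogMoment P₁ Z) {c : S → ℝ} (hc : ∀ x, 0 ≤ c x) :
    Integrable (fun z => √(∑ x, c x * M.ratio x z)) M.noise := by
  refine ((integrable_const (1 : ℝ)).add (h.integrable_sum_ratio hM hlog c)).mono'
    (M.measurable_sum_ratio c).sqrt.aestronglyMeasurable (Eventually.of_forall fun z => ?_)
  rw [Real.norm_of_nonneg (Real.sqrt_nonneg _)]
  exact sqrt_le_one_add (Finset.sum_nonneg fun x _ => mul_nonneg (hc x) (M.ratio_nonneg x z))

/-- The Hellinger affinity of a mixture of signal densities and the noise density is less than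
one. -/
theorem Model.IsSignal.integral_sqrt_lt_one (h : M.IsSignal P₁ X Z) (hM : M.Ergodic)
    (hmix : M.Distinguishable) (hlog : M.FiniteLogMoment P₁ Z) {c : S → ℝ}
    (hc : c ∈ stdSimplex ℝ S) :
    ∫ z, √(∑ x, c x * M.ratio x z) ∂M.noise < 1 := by
  set Y : 𝒵 → ℝ := fun z => ∑ x, c x * M.ratio x z with hY
  have hY0 : ∀ z, 0 ≤ Y z := fun z =>
    Finset.sum_nonneg fun x _ => mul_nonneg (hc.1 x) (M.ratio_nonneg x z)
  have hYi : Integrable Y M.noise := h.integrable_sum_ratio hM hlog c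
  have hYs : Integrable (fun z => √(Y z)) M.noise := h.integrable_sqrt hM hlog hc.1
  have hY1 : ∫ z, Y z ∂M.noise = 1 := by
    rw [integral_finsetSum _ fun x _ => (h.integrable_ratio hM hlog x).const_mul _]
    simp_rw [integral_const_mul, h.integral_ratio hM hlog, mul_one]
    exact hc.2
  by_contra! hge
  -- As $\int Y=1$, the square integrates to $2-2\int\sqrt Y$; an affinity of at least one would
  -- thus force $Y=1$ almost everywhere.
  have hsq : ∀ z, (√(Y z) - 1) ^ 2 = Y z + 1 - 2 * √(Y z) := fun z => by
    nlinarith [Real.sq_sqrt (hY0 z)]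
  have hint : Integrable (fun z => (√(Y z) - 1) ^ 2) M.noise := by
    simp_rw [hsq]
    exact (hYi.add (integrable_const 1)).sub (hYs.const_mul 2)
  have h0 : ∫ z, (√(Y z) - 1) ^ 2 ∂M.noise = 0 := by
    refine le_antisymm ?_ (integral_nonneg fun z => sq_nonneg _)
    simp_rw [hsq]
    have hi1 : Integrable (fun z => Y z + 1) M.noise := hYi.add (integrable_const 1)
    rw [integral_sub hi1 (hYs.const_mul 2), integral_add hYi (integrable_const 1),
      integral_const_mul, hY1]
    simp only [integral_const, probReal_univ, smul_eq_mul, mul_one]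
    linarith
  rw [integral_eq_zero_iff_of_nonneg (fun z => sq_nonneg _) hint] at h0
  have h1 : ∀ᵐ z ∂M.noise, Y z = 1 := by
    filter_upwards [h0] with z hz
    have : √(Y z) = 1 := by
      have := pow_eq_zero_iff (two_ne_zero) |>.1 hz
      linarith
    rwa [Real.sqrt_eq_one] at this
  rw [Model.noise, ae_withDensity_iff M.f₀_measurable.ennreal_ofReal] at h1
  have hN : MeasurableSet {z | M.f₀ z ≤ 0} := measurableSet_le M.f₀_measurable measurable_const
  -- The noise law does not see $\{f_0=0\}$; there both densities vanish, so that equality holds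
  -- $\nu$-almost everywhere.
  have h2 : ∀ x, ∀ᵐ z ∂ν, M.f₀ z ≤ 0 → M.f x z = 0 := fun x => by
    have h0 := h.lintegral_f_eq_zero hM hN
      (by filter_upwards [(hlog x).1] with ω hω hω'; exact absurd hω.2 (not_lt.2 hω')) x
    rw [lintegral_eq_zero_iff (M.f_measurable x).ennreal_ofReal, Filter.EventuallyEq,
      ae_restrict_iff' hN] at h0
    filter_upwards [h0] with z hz hz'
    exact le_antisymm (ENNReal.ofReal_eq_zero.1 (hz hz')) (M.f_nonneg x z)
  refine hmix c hc ?_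
  filter_upwards [h1, ae_all_iff.2 h2] with z hz hz2
  rcases (M.f₀_nonneg z).eq_or_lt with h3 | h3
  · rw [← h3]
    exact Finset.sum_eq_zero fun x _ => by rw [hz2 x h3.symm.le, mul_zero]
  · have h4 := hz (by simpa using h3)
    simp only [hY, Model.ratio] at h4
    simp_rw [← mul_div_assoc] at h4
    rw [← Finset.sum_div, div_eq_one_iff_eq h3.ne'] at h4
    exact h4

/-- The affinity is continuous on the compact simplex, so its maximum is attained and is less than
one. Homogeneity of degree $1/2$ extends the bound to unnormalised weights, the form needed for the
weights `fwd`. -/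
theorem Model.IsSignal.exists_affinity_bound (h : M.IsSignal P₁ X Z) (hM : M.Ergodic)
    (hmix : M.Distinguishable) (hlog : M.FiniteLogMoment P₁ Z) :
    ∃ ρ : ℝ, 0 < ρ ∧ ρ < 1 ∧ ∀ c : S → ℝ, (∀ x, 0 ≤ c x) →
      ∫⁻ z, ENNReal.ofReal √(∑ x, c x * M.ratio x z) ∂M.noise ≤
        ENNReal.ofReal ρ * ENNReal.ofReal √(∑ x, c x) := by
  set φ : (S → ℝ) → ℝ := fun c => ∫ z, √(∑ x, c x * M.ratio x z) ∂M.noise with hφ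
  have hcont : ContinuousOn φ (stdSimplex ℝ S) := by
    refine continuousOn_of_dominated (bound := fun z => 1 + ∑ x, 1 * M.ratio x z) ?_ ?_ ?_ ?_
    · exact fun c _ => (M.measurable_sum_ratio c).sqrt.aestronglyMeasurable
    · refine fun c hc => Eventually.of_forall fun z => ?_
      rw [Real.norm_of_nonneg (Real.sqrt_nonneg _)]
      refine (sqrt_le_one_add (Finset.sum_nonneg fun x _ =>
        mul_nonneg (hc.1 x) (M.ratio_nonneg x z))).trans ?_
      gcongr with x
      · exact M.ratio_nonneg x z
      · rw [← hc.2]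
        exact Finset.single_le_sum (fun y _ => hc.1 y) (Finset.mem_univ x)
    · exact (integrable_const 1).add (h.integrable_sum_ratio hM hlog _)
    · exact Eventually.of_forall fun z => by fun_prop
  obtain ⟨c₀, hc₀, hmax⟩ := (isCompact_stdSimplex ℝ S).exists_isMaxOn ⟨_, M.start_mem⟩ hcont
  have hlt := h.integral_sqrt_lt_one hM hmix hlog hc₀
  -- The $1/2$ only secures $\rho>0$, since $\ln\rho$ is used later.
  refine ⟨max (φ c₀) (1 / 2), by positivity, max_lt hlt (by norm_num), fun c hc => ?_⟩
  have hs0 : 0 ≤ ∑ x, c x := Finset.sum_nonneg fun x _ => hc x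
  rcases hs0.eq_or_lt with hs | hs
  · have : ∀ x, c x = 0 := fun x =>
      (Finset.sum_eq_zero_iff_of_nonneg fun x _ => hc x).1 hs.symm x (Finset.mem_univ x)
    simp [this]
  set s := ∑ x, c x with hs_def
  have hmem : (fun x => c x / s) ∈ stdSimplex ℝ S :=
    ⟨fun x => div_nonneg (hc x) hs0, by rw [← Finset.sum_div, div_self hs.ne']⟩
  have h1 : ∀ z, √(∑ x, c x * M.ratio x z) = √s * √(∑ x, c x / s * M.ratio x z) := fun z => by
    rw [← Real.sqrt_mul hs0, Finset.mul_sum]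
    congr 1
    refine Finset.sum_congr rfl fun x _ => ?_
    field_simp
  rw [← ofReal_integral_eq_lintegral_ofReal (h.integrable_sqrt hM hlog hc)
    (Eventually.of_forall fun z => Real.sqrt_nonneg _),
    ← ENNReal.ofReal_mul (by positivity)]
  refine ENNReal.ofReal_le_ofReal ?_
  simp_rw [h1]
  rw [integral_const_mul, mul_comm]
  gcongr
  exact (hmax hmem).trans (le_max_left _ _)

theorem Model.prodStep_congr (M : Model S 𝒵 ν) {k : ℕ}
    {z z' : ℕ → 𝒵} (h : ∀ i < k, z i = z' i) : M.prodStep k z = M.prodStep k z' := by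
  induction k generalizing z z' with
  | zero => rfl
  | succ k ih =>
    rw [Model.prodStep, Model.prodStep, h 0 k.succ_pos,
      ih (z := shift z) (z' := shift z') fun i hi => h (i + 1) (Nat.succ_lt_succ hi)]

theorem Model.measurable_prodStep (M : Model S 𝒵 ν) (k : ℕ) (x y : S) :
    Measurable fun z => M.prodStep k z x y := by
  induction k generalizing x with
  | zero => exact measurable_const
  | succ k ih =>
    simp only [Model.prodStep, Matrix.mul_apply, Model.step]
    exact Finset.measurable_sum _ fun w _ => ((((M.measurable_ratio x).comp
      (measurable_pi_apply 0)).mul_const _)).mul ((ih w).comp measurable_shift)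

theorem Model.measurable_fwd (M : Model S 𝒵 ν) (k : ℕ) : Measurable (M.fwd k) :=
  measurable_pi_lambda _ fun y => Finset.measurable_sum _ fun x _ =>
    (M.measurable_prodStep k x y).const_mul _

theorem Model.pathLr_succ (M : Model S 𝒵 ν) (k : ℕ) (z : ℕ → 𝒵) :
    M.pathLr (k + 1) z = ∑ x, M.fwd k z x * M.ratio x (z k) := by
  rw [M.pathLr_add]
  refine Finset.sum_congr rfl fun x _ => ?_
  rw [M.lrFrom_succ, M.lrFrom_zero, shift_iterate_apply, zero_add]
  simp [M.sum_trans]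

theorem Model.IsNoise.indepFun_fwd [IsProbabilityMeasure P₀] (h : M.IsNoise P₀ Z) (k : ℕ) :
    IndepFun (fun ω => M.fwd k (path Z ω)) (Z k) P₀ := by
  obtain ⟨z₀⟩ : Nonempty 𝒵 := nonempty_of_isProbabilityMeasure M.noise
  -- Padding with a dummy value exhibits `fwd k` as a function of the first `k` measurements.
  set ext : (Fin k → 𝒵) → ℕ → 𝒵 := fun a i => if h : i < k then a ⟨i, h⟩ else z₀
  have hext : Measurable ext := measurable_pi_lambda _ fun i => by
    by_cases hi : i < k
    · simpa [ext, hi] using measurable_pi_apply _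
    · simp [ext, hi]
  have h1 := (h.indepFun_pre_iterate_shift k).comp ((M.measurable_fwd k).comp hext)
    (measurable_pi_apply 0)
  have e1 : (M.fwd k ∘ ext) ∘ (fun ω => pre k (path Z ω)) = fun ω => M.fwd k (path Z ω) := by
    funext ω
    simp only [Function.comp_apply, Model.fwd]
    rw [M.prodStep_congr (z := ext (pre k (path Z ω))) (z' := path Z ω) fun i hi => by
      simp [ext, hi, pre]]
  have e2 : (fun z : ℕ → 𝒵 => z 0) ∘ (fun ω => shift^[k] (path Z ω)) = Z k := by
    funext ω
    simp [iterate_shift_path]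
  rwa [e1, e2] at h1

/-- Given the first $k$ measurements, $\Lambda_{k+1}$ is a combination of the ratios of a fresh
measurement with weights `fwd`, whose sum is $\Lambda_k$. The affinity bound therefore gains a
factor $\rho$ at each step. -/
theorem Model.IsNoise.lintegral_sqrt_pathLr_le [IsProbabilityMeasure P₀] (h₀ : M.IsNoise P₀ Z)
    {ρ : ℝ} (hρ : ∀ c : S → ℝ, (∀ x, 0 ≤ c x) →
      ∫⁻ z, ENNReal.ofReal √(∑ x, c x * M.ratio x z) ∂M.noise ≤
        ENNReal.ofReal ρ * ENNReal.ofReal √(∑ x, c x)) (k : ℕ) :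
    ∫⁻ ω, ENNReal.ofReal √(M.pathLr k (path Z ω)) ∂P₀ ≤ ENNReal.ofReal ρ ^ k := by
  induction k with
  | zero => simp [M.pathLr_eq_sum, M.lrFrom_zero, M.sum_start]
  | succ k ih =>
    have hW : Measurable fun ω => M.fwd k (path Z ω) :=
      (M.measurable_fwd k).comp (measurable_path h₀.measurable)
    have hmap := (indepFun_iff_map_prod_eq_prod_map_map hW.aemeasurable
      (h₀.measurable k).aemeasurable).1 (h₀.indepFun_fwd k)
    have hlaw : P₀.map (Z k) = M.noise := h₀.law k
    rw [hlaw] at hmap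
    have hG : Measurable fun p : (S → ℝ) × 𝒵 =>
        ENNReal.ofReal √(∑ x, p.1 x * M.ratio x p.2) := by
      refine (Measurable.sqrt (Finset.measurable_sum _ fun x _ => ?_)).ennreal_ofReal
      exact ((measurable_pi_apply x).comp measurable_fst).mul
        ((M.measurable_ratio x).comp measurable_snd)
    have hS : Measurable fun w : S → ℝ => ENNReal.ofReal √(∑ x, w x) :=
      (Measurable.sqrt (Finset.measurable_sum _ fun x _ => measurable_pi_apply x)).ennreal_ofReal
    have hnonneg : ∀ᵐ w ∂(P₀.map fun ω => M.fwd k (path Z ω)), ∀ x, 0 ≤ w x := by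
      refine (ae_map_iff hW.aemeasurable ?_).2 (Eventually.of_forall fun ω x => M.fwd_nonneg _ _ _)
      rw [ofPred_forall]
      exact MeasurableSet.iInter fun x => measurableSet_le measurable_const (measurable_pi_apply x)
    have := Measure.isProbabilityMeasure_map (μ := P₀) hW.aemeasurable
    calc ∫⁻ ω, ENNReal.ofReal √(M.pathLr (k + 1) (path Z ω)) ∂P₀
        = ∫⁻ p, ENNReal.ofReal √(∑ x, p.1 x * M.ratio x p.2)
            ∂((P₀.map fun ω => M.fwd k (path Z ω)).prod M.noise) := by
          rw [← hmap, lintegral_map hG (hW.prodMk (h₀.measurable k))]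
          simp_rw [M.pathLr_succ]
          rfl
      _ = ∫⁻ w, ∫⁻ z, ENNReal.ofReal √(∑ x, w x * M.ratio x z) ∂M.noise
            ∂(P₀.map fun ω => M.fwd k (path Z ω)) := lintegral_prod _ hG.aemeasurable
      _ ≤ ∫⁻ w, ENNReal.ofReal ρ * ENNReal.ofReal √(∑ x, w x)
            ∂(P₀.map fun ω => M.fwd k (path Z ω)) := by
          refine lintegral_mono_ae ?_
          filter_upwards [hnonneg] with w hw using hρ w hw
      _ = ENNReal.ofReal ρ * ∫⁻ ω, ENNReal.ofReal √(M.pathLr k (path Z ω)) ∂P₀ := by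
          rw [lintegral_const_mul _ hS, lintegral_map hS hW]
          simp_rw [M.pathLr_eq_sum_fwd]
      _ ≤ ENNReal.ofReal ρ ^ (k + 1) := by
          rw [pow_succ']
          gcongr

/-- Jensen's inequality, through the tangent bound $\ln(y/\rho^k)\le y/\rho^k-1$. -/
theorem integral_log_le_of_lintegral_le {μ : Measure Ω} [IsProbabilityMeasure μ] {Y : Ω → ℝ}
    (hYm : Measurable Y) (hY : ∀ᵐ ω ∂μ, 0 < Y ω) (hlog : Integrable (fun ω => Real.log (Y ω)) μ)
    {ρ : ℝ} (hρ : 0 < ρ) {k : ℕ} (h : ∫⁻ ω, ENNReal.ofReal (Y ω) ∂μ ≤ ENNReal.ofReal ρ ^ k) :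
    ∫ ω, Real.log (Y ω) ∂μ ≤ k * Real.log ρ := by
  have hY' : 0 ≤ᵐ[μ] Y := hY.mono fun ω hω => hω.le
  have hρk : 0 < ρ ^ k := pow_pos hρ k
  have hYi : Integrable Y μ := by
    refine ⟨hYm.aestronglyMeasurable, ?_⟩
    rw [hasFiniteIntegral_iff_ofReal hY']
    exact h.trans_lt (ENNReal.pow_lt_top ENNReal.ofReal_lt_top)
  have hYle : ∫ ω, Y ω ∂μ ≤ ρ ^ k := by
    rw [integral_eq_lintegral_of_nonneg_ae hY' hYm.aestronglyMeasurable]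
    refine ENNReal.toReal_le_of_le_ofReal hρk.le ?_
    rwa [ENNReal.ofReal_pow hρ.le]
  have h1 : ∫ ω, Real.log (Y ω) ∂μ ≤ ∫ ω, (Y ω / ρ ^ k + (k * Real.log ρ - 1)) ∂μ := by
    refine integral_mono_ae hlog ((hYi.div_const _).add (integrable_const _)) ?_
    filter_upwards [hY] with ω hω
    have := Real.log_le_sub_one_of_pos (div_pos hω hρk)
    rw [Real.log_div hω.ne' hρk.ne', Real.log_pow] at this
    linarith
  rw [integral_add (hYi.div_const _) (integrable_const _), integral_div] at h1
  have h2 : (∫ ω, Y ω ∂μ) / ρ ^ k ≤ 1 := (div_le_one hρk).2 hYle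
  simp only [integral_const, probReal_univ, smul_eq_mul, one_mul] at h1
  linarith

theorem Model.ae_pathLr_pos (hZ : ∀ i, Measurable (Z i)) (hlog : M.FiniteLogMoment P Z)
    (hμ : MeasurePreserving shift (P.map (path Z)) (P.map (path Z))) :
    ∀ᵐ ω ∂P, ∀ k, 0 < M.pathLr k (path Z ω) := by
  filter_upwards [ae_of_ae_map (measurable_path hZ).aemeasurable (hlog.ae_posPath hZ hμ)] with ω hω
  exact fun k => M.pathLr_pos hω k

theorem Model.measurable_pathLr_path (hZ : ∀ i, Measurable (Z i)) (k : ℕ) :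
    Measurable fun ω => M.pathLr k (path Z ω) :=
  (M.measurable_pathLr k).comp (measurable_path hZ)

/-- Since $E_0\Lambda_k=1$, Jensen's inequality for $\Lambda_k$ itself gives only $\lambda_0\le0$;
the square root decays geometrically and gives $\lambda_0\le2\ln\rho$. -/
theorem Model.logRate_noise_neg [IsProbabilityMeasure P₀] (h₀ : M.IsNoise P₀ Z)
    (h₁ : M.IsSignal P₁ X Z) (hM : M.Ergodic) (hmix : M.Distinguishable)
    (hlog₀ : M.FiniteLogMoment P₀ Z) (hlog₁ : M.FiniteLogMoment P₁ Z) {c : ℝ}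
    (hc : M.IsLogRate P₀ Z c) : c < 0 := by
  obtain ⟨ρ, hρ, hρ1, hb⟩ := h₁.exists_affinity_bound hM hmix hlog₁
  have hpos := M.ae_pathLr_pos h₀.measurable hlog₀ h₀.measurePreserving_shift
  have hle : ∀ k : ℕ, ∫ ω, Real.log (M.pathLr k (path Z ω)) ∂P₀ ≤ k * (2 * Real.log ρ) := by
    intro k
    have hm := M.measurable_pathLr_path (ν := ν) h₀.measurable k
    have hsqrt : (fun ω => Real.log √(M.pathLr k (path Z ω))) =
        fun ω => Real.log (M.pathLr k (path Z ω)) / 2 := by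
      funext ω
      rw [Real.log_sqrt (M.pathLr_nonneg _ _)]
    have := integral_log_le_of_lintegral_le hm.sqrt
      (hpos.mono fun ω hω => Real.sqrt_pos.2 (hω k)) (by
        rw [hsqrt]
        exact (hc.1 k).div_const 2) hρ (h₀.lintegral_sqrt_pathLr_le hb k)
    rw [hsqrt, integral_div] at this
    linarith
  have hlim : c ≤ 2 * Real.log ρ := by
    refine le_of_tendsto hc.2 ?_
    filter_upwards [eventually_ge_atTop 1] with k hk
    have hk0 : (0 : ℝ) < k := by exact_mod_cast hk
    rw [inv_mul_le_iff₀ hk0]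
    exact hle k
  have := Real.log_neg hρ hρ1
  linarith

theorem Model.logRate_signal_pos [IsProbabilityMeasure P₀] [IsProbabilityMeasure P₁]
    (h₀ : M.IsNoise P₀ Z) (h₁ : M.IsSignal P₁ X Z) (hM : M.Ergodic) (hmix : M.Distinguishable)
    (hlog₁ : M.FiniteLogMoment P₁ Z) {c : ℝ} (hc : M.IsLogRate P₁ Z c) : 0 < c := by
  obtain ⟨ρ, hρ, hρ1, hb⟩ := h₁.exists_affinity_bound hM hmix hlog₁
  have hpos := M.ae_pathLr_pos h₁.measurable hlog₁ (h₁.measurePreserving_shift hM.stationary)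
  have hp := measurable_path h₁.measurable
  have hle : ∀ k : ℕ, -∫ ω, Real.log (M.pathLr k (path Z ω)) ∂P₁ ≤ k * (2 * Real.log ρ) := by
    intro k
    have hm := M.measurable_pathLr_path (ν := ν) h₁.measurable k
    have hsqrt : (fun ω => Real.log (√(M.pathLr k (path Z ω)))⁻¹) =
        fun ω => -(Real.log (M.pathLr k (path Z ω)) / 2) := by
      funext ω
      rw [Real.log_inv, Real.log_sqrt (M.pathLr_nonneg _ _)]
    -- $E_1\Lambda_k^{-1/2}=E_0[\Lambda_k\Lambda_k^{-1/2}]$, so the affinity bound under noise also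
    -- serves here.
    have hinv : ∫⁻ ω, ENNReal.ofReal (√(M.pathLr k (path Z ω)))⁻¹ ∂P₁ =
        ∫⁻ ω, ENNReal.ofReal √(M.pathLr k (path Z ω)) ∂P₀ := by
      have h2 := M.lintegral_signal h₀ h₁ hM hlog₁ (k := k)
        (F := fun z => ENNReal.ofReal (√(M.lr k z))⁻¹) (M.measurable_lr k).sqrt.inv.ennreal_ofReal
      have hm1 := (M.measurable_pathLr k).sqrt.inv.ennreal_ofReal
      have hm2 : Measurable fun z => ENNReal.ofReal (M.pathLr k z) *
          ENNReal.ofReal (√(M.pathLr k z))⁻¹ := (M.measurable_pathLr k).ennreal_ofReal.mul hm1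
      have e1 := lintegral_map (μ := P₁) hm1 hp
      have e2 := lintegral_map (μ := P₀) hm2 hp
      refine e1.symm.trans (h2.trans (e2.trans (lintegral_congr fun ω => ?_)))
      rw [← ENNReal.ofReal_mul (M.pathLr_nonneg _ _), ← div_eq_mul_inv, Real.div_sqrt]
    have := integral_log_le_of_lintegral_le hm.sqrt.inv
      (hpos.mono fun ω hω => inv_pos.2 (Real.sqrt_pos.2 (hω k))) (by
        simp only [Pi.inv_apply]
        rw [hsqrt]
        exact ((hc.1 k).div_const 2).neg) hρ
        (hinv.trans_le (h₀.lintegral_sqrt_pathLr_le hb k))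
    simp only [Pi.inv_apply] at this
    rw [hsqrt, integral_neg, integral_div] at this
    linarith
  have hlim : -c ≤ 2 * Real.log ρ := by
    refine le_of_tendsto hc.2.neg ?_
    filter_upwards [eventually_ge_atTop 1] with k hk
    have hk0 : (0 : ℝ) < k := by exact_mod_cast hk
    rw [← mul_neg, inv_mul_le_iff₀ hk0]
    exact hle k
  have := Real.log_neg hρ hρ1
  linarith

end Rates

/-! ### Exit times of a process with drift, and a lower bound for competing sample sizes. -/

section Stopping

theorem exists_iInf_eq_coe {p : ℕ → Prop} (h : ∃ k, p k) :
    ∃ n : ℕ, p n ∧ (∀ k < n, ¬ p k) ∧ (⨅ (k : ℕ) (_ : p k), (k : ℕ∞)) = n := by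
  classical
  refine ⟨Nat.find h, Nat.find_spec h, fun k hk => Nat.find_min h hk, le_antisymm
    (iInf₂_le _ (Nat.find_spec h)) (le_iInf₂ fun k hk => ?_)⟩
  exact_mod_cast Nat.find_min' h hk

theorem tendsto_atBot_of_div_tendsto_neg {u : ℕ → ℝ} {c : ℝ} (hc : c < 0)
    (hu : Tendsto (fun k : ℕ => u k / k) atTop (𝓝 c)) : Tendsto u atTop atBot := by
  refine (hu.neg_mul_atTop hc tendsto_natCast_atTop_atTop).congr' ?_
  filter_upwards [eventually_ge_atTop 1] with k hk
  have : (k : ℝ) ≠ 0 := by positivity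
  field_simp

/-- The first time at which a sequence with negative drift `c` leaves the interval `(-a, b)` is
asymptotic to `a / |c|`. -/
theorem tendsto_exit_time {u : ℕ → ℝ} {c : ℝ} (hc : c < 0)
    (hu : Tendsto (fun k : ℕ => u k / k) atTop (𝓝 c)) {J : Type*} {l : Filter J} {a b d : J → ℝ}
    (ha : Tendsto a l atTop) (hb : Tendsto b l atTop) (hd : Tendsto d l atTop)
    (had : Tendsto (fun j => a j / d j) l (𝓝 1)) {τ : J → ℕ∞}
    (hτ : ∀ j, τ j = ⨅ (k : ℕ) (_ : 1 ≤ k ∧ (u k ≤ -a j ∨ b j ≤ u k)), (k : ℕ∞)) :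
    Tendsto (fun j => (τ j : ℝ≥0∞) / ENNReal.ofReal (d j)) l (𝓝 (ENNReal.ofReal (1 / |c|))) := by
  have hbot := tendsto_atBot_of_div_tendsto_neg hc hu
  have hex : ∀ j, ∃ k, 1 ≤ k ∧ (u k ≤ -a j ∨ b j ≤ u k) := fun j => by
    obtain ⟨k, hk, hk'⟩ := ((hbot.eventually_le_atBot (-a j)).and (eventually_ge_atTop 1)).exists
    exact ⟨k, hk', Or.inl hk⟩
  choose N hN hNmin hNeq using fun j => exists_iInf_eq_coe (hex j)
  -- Once both thresholds exceed every $|u_k|$ with $k<K$, no exit occurs before $K$.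
  have hNtop : Tendsto N l atTop := by
    refine tendsto_atTop.2 fun K => ?_
    filter_upwards [ha.eventually_gt_atTop (∑ k ∈ Finset.range K, |u k|),
      hb.eventually_gt_atTop (∑ k ∈ Finset.range K, |u k|)] with j h1 h2
    by_contra! hlt
    have h3 := Finset.single_le_sum (f := fun k => |u k|) (fun _ _ => abs_nonneg _)
      (Finset.mem_range.2 hlt)
    have h4 := neg_abs_le (u (N j))
    have h5 := le_abs_self (u (N j))
    rcases (hN j).2 with h | h <;> linarith
  have hlow : ∀ᶠ j in l, u (N j) ≤ -a j := by
    filter_upwards [hNtop.eventually (hbot.eventually_lt_atBot 0), hb.eventually_gt_atTop 0]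
      with j h1 h2
    rcases (hN j).2 with h | h
    · exact h
    · linarith
  have hN1 : Tendsto (fun j => -(u (N j) / N j)) l (𝓝 (-c)) := (hu.comp hNtop).neg
  -- The level is squeezed, $-u_{N-1}<a\le-u_N$, and both sides divided by $N$ tend to $-c$. The
  -- lower bound needs $N\ge2$, since exits are only counted from time $1$.
  have hsub : Tendsto (fun k : ℕ => -(u (k - 1) / k)) atTop (𝓝 (-c)) := by
    have h1 : Tendsto (fun k : ℕ => u k / k * (k / (k + 1 : ℕ))) atTop (𝓝 (c * 1)) := by
      refine hu.mul ?_
      have := tendsto_natCast_div_add_atTop (1 : ℝ)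
      simpa using this
    rw [mul_one] at h1
    rw [← tendsto_add_atTop_iff_nat 1]
    refine h1.neg.congr' ?_
    filter_upwards [eventually_ge_atTop 1] with k hk
    have : (k : ℝ) ≠ 0 := by positivity
    rw [Nat.add_sub_cancel]
    field_simp
  have haN : Tendsto (fun j => a j / N j) l (𝓝 (-c)) := by
    refine tendsto_of_tendsto_of_tendsto_of_le_of_le' (hsub.comp hNtop) hN1 ?_ ?_
    · filter_upwards [hNtop.eventually_ge_atTop 2] with j hj
      have h1 := hNmin j (N j - 1) (by omega)
      push Not at h1
      have h2 := (h1 (by omega)).1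
      rw [Function.comp_apply, ← neg_div]
      gcongr
      linarith
    · filter_upwards [hlow] with j hj
      rw [← neg_div]
      gcongr
      linarith
  have hreal : Tendsto (fun j => (N j : ℝ) / d j) l (𝓝 (1 / |c|)) := by
    have h1 := (haN.inv₀ (neg_pos.2 hc).ne').mul had
    rw [mul_one, ← one_div, ← abs_of_neg hc] at h1
    refine h1.congr' ?_
    filter_upwards [ha.eventually_gt_atTop 0] with j hj
    field_simp
  refine (ENNReal.tendsto_ofReal hreal).congr' ?_
  filter_upwards [hd.eventually_gt_atTop 0] with j hj
  rw [hτ, hNeq, ENNReal.ofReal_div_of_pos hj, ENNReal.ofReal_natCast]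
  simp

variable {Ω : Type*} [MeasurableSpace Ω] {P : Measure Ω}

theorem tendsto_measure_zero_of_ae_eventually [IsFiniteMeasure P] {A : ℕ → Set Ω}
    (hA : ∀ n, MeasurableSet (A n)) (h : ∀ᵐ ω ∂P, ∀ᶠ n in atTop, ω ∉ A n) :
    Tendsto (fun n => P (A n)) atTop (𝓝 0) := by
  have := tendsto_measure_of_ae_tendsto_indicator_of_isFiniteMeasure (μ := P) atTop
    MeasurableSet.empty hA (by
      filter_upwards [h] with ω hω
      filter_upwards [hω] with n hn
      simpa using hn)
  simpa using this

/-- Late terms satisfy $u_k\ge-k_0k\ge-k_0m$; the finitely many early ones are absorbed as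
$k_0m\to\infty$. -/
theorem eventually_running_ge {u : ℕ → ℝ} {c k₀ : ℝ} (hk₀ : 0 < k₀) (hc : -k₀ < c)
    (hu : Tendsto (fun k : ℕ => u k / k) atTop (𝓝 c)) :
    ∀ᶠ m : ℕ in atTop, ∀ k ≤ m, -(k₀ * m) ≤ u k := by
  obtain ⟨K, hK⟩ := eventually_atTop.1
    ((hu.eventually (lt_mem_nhds hc)).and (eventually_ge_atTop 1))
  have h1 : Tendsto (fun m : ℕ => k₀ * (m : ℝ)) atTop atTop :=
    tendsto_natCast_atTop_atTop.const_mul_atTop hk₀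
  filter_upwards [h1.eventually_ge_atTop (∑ k ∈ Finset.range K, |u k|)] with m hm k hkm
  rcases lt_or_ge k K with h | h
  · have h3 := Finset.single_le_sum (f := fun k => |u k|) (fun _ _ => abs_nonneg _)
      (Finset.mem_range.2 h)
    have h4 := neg_abs_le (u k)
    linarith
  · obtain ⟨h2, h3⟩ := hK k h
    have hk0 : (0 : ℝ) < k := by exact_mod_cast h3
    rw [lt_div_iff₀ hk0] at h2
    have h4 : k₀ * (k : ℝ) ≤ k₀ * m := by gcongr
    linarith

/-- If a test that stops before the process `u` has reached the level `-C` is bound to have error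
probability at most about `exp (C - a)`, then its sample size is, with high probability, not much
smaller than the time at which `u` reaches the level `-b`, where `b` is asymptotic to `a`. -/
theorem tendsto_iInf_measure_lt [IsProbabilityMeasure P] {u : ℕ → Ω → ℝ} {c : ℝ} (hc : c < 0)
    (hum : ∀ k, Measurable (u k))
    (hu : ∀ᵐ ω ∂P, Tendsto (fun k : ℕ => u k ω / k) atTop (𝓝 c)) {J ι : Type*} {l : Filter J}
    {a b : J → ℝ} {e : J → ℝ≥0∞} (ha : Tendsto a l atTop)
    (hba : Tendsto (fun j => b j / a j) l (𝓝 1)) (he : Tendsto e l (𝓝 0)) {τ : J → Ω → ℕ∞}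
    (hτ : ∀ j n ω, 1 ≤ n → u n ω ≤ -b j → τ j ω ≤ n) {𝒯 : J → Set ι} (h𝒯 : ∀ j, (𝒯 j).Nonempty)
    {N : ι → Ω → ℕ∞}
    (hN : ∀ j, ∀ T ∈ 𝒯 j, ∀ C : ℝ, P {ω | ∃ k : ℕ, N T ω = k ∧ -C ≤ u k ω} ≤
      ENNReal.ofReal (Real.exp (C - a j)) + e j) {ε : ℝ} (hε : ε ∈ Ioo (0 : ℝ) 1) :
    Tendsto (fun j => ⨅ T ∈ 𝒯 j, P {ω | ENNReal.ofReal ε * (τ j ω : ℝ≥0∞) < (N T ω : ℝ≥0∞)}) l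
      (𝓝 1) := by
  obtain ⟨hε0, hε1⟩ := hε
  set κ := -c with hκ
  have hκ0 : 0 < κ := neg_pos.2 hc
  -- With $1<t<1/\varepsilon$ and $\varepsilon t<s<1$, take $n\approx ta/\kappa$ and
  -- $m\approx\varepsilon ta/\kappa$. At time $n$ the process is typically below $-\kappa'n<-b$, so
  -- $\tau\le n$; up to time $m$ it typically stays above $-\kappa''m\ge-sa$. The slopes satisfy
  -- $\kappa/t<\kappa'<\kappa<\kappa''$.
  obtain ⟨t, ht1, ht⟩ := exists_between ((one_lt_div hε0).2 hε1)
  have ht0 : 0 < t := one_pos.trans ht1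
  have hθ : ε * t < 1 := by rwa [lt_div_iff₀ hε0, mul_comm] at ht
  obtain ⟨s, hs, hs1⟩ := exists_between hθ
  have hθ0 : 0 < ε * t := mul_pos hε0 ht0
  have hs0 : 0 < s := hθ0.trans hs
  obtain ⟨κ', hκ'1, hκ'2⟩ := exists_between (div_lt_self hκ0 ht1)
  set κ'' := s * κ / (ε * t) with hκ''
  have hκ''1 : κ < κ'' := by
    rw [hκ'', lt_div_iff₀ hθ0, mul_comm]
    gcongr
  set n : J → ℕ := fun j => ⌊t / κ * a j⌋₊ with hn
  set m : J → ℕ := fun j => ⌊ε * t / κ * a j⌋₊ with hm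
  have htκ : 0 < t / κ := div_pos ht0 hκ0
  have hn_top : Tendsto n l atTop :=
    tendsto_nat_floor_atTop.comp (ha.const_mul_atTop htκ)
  have hm_top : Tendsto m l atTop :=
    tendsto_nat_floor_atTop.comp (ha.const_mul_atTop (div_pos hθ0 hκ0))
  have hna : Tendsto (fun j => (n j : ℝ) / a j) l (𝓝 (t / κ)) :=
    (tendsto_nat_floor_mul_div_atTop htκ.le).comp ha
  have hbn : Tendsto (fun j => b j / n j) l (𝓝 (κ / t)) := by
    have h1 := hba.div hna htκ.ne'
    rw [one_div_div] at h1
    refine h1.congr' ?_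
    filter_upwards [ha.eventually_gt_atTop 0] with j hj
    simp only [Pi.div_apply]
    field_simp
  have hbad1 : Tendsto (fun n : ℕ => P {ω | -(κ' * n) < u n ω}) atTop (𝓝 0) := by
    refine tendsto_measure_zero_of_ae_eventually
      (fun n => measurableSet_lt measurable_const (hum n)) ?_
    filter_upwards [hu] with ω hω
    filter_upwards [hω.eventually (gt_mem_nhds (show c < -κ' by linarith)),
      eventually_ge_atTop 1] with n h1 h2
    have hn0 : (0 : ℝ) < n := by exact_mod_cast h2
    rw [div_lt_iff₀ hn0] at h1
    rw [not_lt]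
    linarith
  have hbad2 : Tendsto (fun m : ℕ => P {ω | ∃ k ≤ m, u k ω < -(κ'' * m)}) atTop (𝓝 0) := by
    refine tendsto_measure_zero_of_ae_eventually (fun m => ?_) ?_
    · have : {ω | ∃ k ≤ m, u k ω < -(κ'' * m)} = ⋃ k, ⋃ (_ : k ≤ m), {ω | u k ω < -(κ'' * m)} := by
        ext ω
        simp
      rw [this]
      exact MeasurableSet.iUnion fun k => MeasurableSet.iUnion fun _ =>
        measurableSet_lt (hum k) measurable_const
    · filter_upwards [hu] with ω hω
      filter_upwards [eventually_running_ge (hκ0.trans hκ''1) (by linarith) hω] with m hm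
      push Not
      exact hm
  have hexp : Tendsto (fun j => ENNReal.ofReal (Real.exp (s * a j - a j))) l (𝓝 0) := by
    rw [← ENNReal.ofReal_zero]
    refine ENNReal.tendsto_ofReal (Real.tendsto_exp_atBot.comp ?_)
    have : Tendsto (fun j => (s - 1) * a j) l atBot := ha.const_mul_atTop_of_neg (by linarith)
    refine this.congr fun j => ?_
    ring
  have hδ : Tendsto (fun j => P {ω | -(κ' * n j) < u (n j) ω} +
      P {ω | ∃ k ≤ m j, u k ω < -(κ'' * m j)} +
      (ENNReal.ofReal (Real.exp (s * a j - a j)) + e j)) l (𝓝 (0 + 0 + (0 + 0))) :=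
    ((hbad1.comp hn_top).add (hbad2.comp hm_top)).add (hexp.add he)
  simp only [add_zero] at hδ
  have hlow := ENNReal.Tendsto.sub (tendsto_const_nhds (x := (1 : ℝ≥0∞))) hδ
    (Or.inl ENNReal.one_ne_top)
  rw [tsub_zero] at hlow
  refine tendsto_of_tendsto_of_tendsto_of_le_of_le' hlow tendsto_const_nhds ?_ ?_
  swap
  · refine Eventually.of_forall fun j => ?_
    obtain ⟨T, hT⟩ := h𝒯 j
    exact (iInf₂_le T hT).trans prob_le_one
  filter_upwards [ha.eventually_gt_atTop 0, hn_top.eventually_ge_atTop 1,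
    hbn.eventually (gt_mem_nhds hκ'1)] with j haj hnj hbj
  have hn0 : (0 : ℝ) < n j := by exact_mod_cast hnj
  rw [div_lt_iff₀ hn0] at hbj
  refine le_iInf₂ fun T hT => tsub_le_iff_right.2 ?_
  -- If $N\le\varepsilon\tau$ and $u$ is typical, then $N\le\varepsilon n$, hence $N\le m$ and
  -- $u_N\ge-sa$. The first two exceptional events do not involve the test and the third has a bound
  -- common to all tests, which gives uniformity.
  have hcover : (univ : Set Ω) ⊆ {ω | ENNReal.ofReal ε * (τ j ω : ℝ≥0∞) < (N T ω : ℝ≥0∞)} ∪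
      (({ω | -(κ' * n j) < u (n j) ω} ∪ {ω | ∃ k ≤ m j, u k ω < -(κ'' * m j)}) ∪
        {ω | ∃ k : ℕ, N T ω = k ∧ -(s * a j) ≤ u k ω}) := by
    intro ω _
    by_cases h1 : -(κ' * n j) < u (n j) ω
    · exact Or.inr (Or.inl (Or.inl h1))
    by_cases h2 : ∃ k ≤ m j, u k ω < -(κ'' * m j)
    · exact Or.inr (Or.inl (Or.inr h2))
    by_cases h3 : ENNReal.ofReal ε * (τ j ω : ℝ≥0∞) < (N T ω : ℝ≥0∞)
    · exact Or.inl h3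
    refine Or.inr (Or.inr ?_)
    push Not at h1 h2 h3
    have h4 : τ j ω ≤ n j := hτ j (n j) ω hnj (by linarith)
    have h5 : ((τ j ω : ℕ∞) : ℝ≥0∞) ≤ (n j : ℝ≥0∞) := by
      exact_mod_cast (ENat.toENNReal_le.2 h4)
    have h6 : (N T ω : ℝ≥0∞) ≤ ENNReal.ofReal (ε * n j) := by
      rw [ENNReal.ofReal_mul hε0.le, ENNReal.ofReal_natCast]
      exact h3.trans (by gcongr)
    obtain ⟨k, hk⟩ : ∃ k : ℕ, N T ω = k := by
      refine ⟨(N T ω).toNat, (ENat.natCast_toNat fun htop => ?_).symm⟩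
      rw [htop] at h6
      simp at h6
    rw [hk] at h6
    have h7 : (k : ℝ) ≤ ε * n j := by
      rw [ENat.toENNReal_coe, ← ENNReal.ofReal_natCast] at h6
      exact (ENNReal.ofReal_le_ofReal_iff (by positivity)).1 h6
    have h8 : (n j : ℝ) ≤ t / κ * a j := Nat.floor_le (by positivity)
    have h9 : k ≤ m j := by
      refine Nat.le_floor (h7.trans ?_)
      calc ε * (n j : ℝ) ≤ ε * (t / κ * a j) := by gcongr
        _ = _ := by ring
    refine ⟨k, hk, le_trans ?_ (h2 k h9)⟩
    have h10 : (m j : ℝ) ≤ ε * t / κ * a j := Nat.floor_le (by positivity)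
    have h11 : κ'' * (m j : ℝ) ≤ κ'' * (ε * t / κ * a j) := by
      gcongr
    have h12 : κ'' * (ε * t / κ * a j) = s * a j := by
      rw [hκ'']
      field_simp
    linarith
  calc (1 : ℝ≥0∞) = P univ := measure_univ.symm
    _ ≤ _ := measure_mono hcover
    _ ≤ _ := by
      refine (measure_union_le _ _).trans (add_le_add le_rfl ((measure_union_le _ _).trans ?_))
      exact add_le_add (measure_union_le _ _) (hN j T hT _)

end Stopping

/-! ### Change of measure at the stopping time of an arbitrary test. -/

section Tests

variable {𝒵 : Type*} [MeasurableSpace 𝒵]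

/-- The sequences of length `k` after which the test stops. -/
def SeqTest.stopSet (T : SeqTest 𝒵) (k : ℕ) : Set (Fin k → 𝒵) :=
  {z | (1 ≤ k ∧ z ∈ T.halt k) ∧
    ∀ i : Fin k, 1 ≤ (i : ℕ) → (fun n : Fin i => z (Fin.castLE i.2.le n)) ∉ T.halt i}

theorem SeqTest.measurableSet_stopSet (T : SeqTest 𝒵) (k : ℕ) : MeasurableSet (T.stopSet k) := by
  have : T.stopSet k = ({_z | 1 ≤ k} ∩ T.halt k) ∩ ⋂ i : Fin k, ⋂ (_ : 1 ≤ (i : ℕ)),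
      (fun (z : Fin k → 𝒵) (n : Fin i) => z (Fin.castLE i.2.le n)) ⁻¹' (T.halt i)ᶜ := by
    ext z
    simp [SeqTest.stopSet]
  rw [this]
  refine ((MeasurableSet.const _).inter (T.halt_measurable k)).inter
    (MeasurableSet.iInter fun i => MeasurableSet.iInter fun _ => ?_)
  exact (measurable_pi_lambda _ fun n => measurable_pi_apply _) (T.halt_measurable i).compl

theorem SeqTest.time_eq_coe_iff (T : SeqTest 𝒵) (z : ℕ → 𝒵) (k : ℕ) :
    T.time z = k ↔ pre k z ∈ T.stopSet k := by
  have hiff : pre k z ∈ T.stopSet k ↔ (1 ≤ k ∧ pre k z ∈ T.halt k) ∧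
      ∀ i < k, ¬ (1 ≤ i ∧ pre i z ∈ T.halt i) := by
    rw [SeqTest.stopSet, mem_ofPred_eq]
    refine and_congr_right fun _ => ⟨fun h i hi hi' => h ⟨i, hi⟩ hi'.1 hi'.2,
      fun h i hi hi' => h i i.2 ⟨hi, hi'⟩⟩
  rw [hiff]
  by_cases hex : ∃ k, 1 ≤ k ∧ pre k z ∈ T.halt k
  · obtain ⟨n, hn, hmin, heq⟩ := exists_iInf_eq_coe hex
    rw [SeqTest.time, heq, Nat.cast_inj]
    constructor
    · rintro rfl
      exact ⟨hn, hmin⟩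
    · rintro ⟨h1, h2⟩
      exact le_antisymm (not_lt.1 fun h => hmin k h h1) (not_lt.1 fun h => h2 n h hn)
  · constructor
    · intro h
      push Not at hex
      rw [SeqTest.time] at h
      have : (⨅ (k : ℕ) (_ : 1 ≤ k ∧ pre k z ∈ T.halt k), (k : ℕ∞)) = ⊤ := by
        simp only [iInf_eq_top]
        exact fun i hi => absurd hi.2 (hex i hi.1)
      rw [this] at h
      exact absurd h.symm (ENat.natCast_ne_top k)
    · exact fun h => absurd ⟨k, h.1⟩ hex

variable {S : Type*} [Fintype S] [DecidableEq S] {ν : Measure 𝒵}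
  {M : Model S 𝒵 ν} {Ω : Type*} [MeasurableSpace Ω] {P₀ P₁ : Measure Ω}
  [IsProbabilityMeasure P₀] [IsProbabilityMeasure P₁] {X : ℕ → Ω → S} {Z : ℕ → Ω → 𝒵}

theorem Model.measure_signal_pre (h₀ : M.IsNoise P₀ Z) (h₁ : M.IsSignal P₁ X Z) (hM : M.Ergodic)
    (hlog₁ : M.FiniteLogMoment P₁ Z) {k : ℕ} {E : Set (Fin k → 𝒵)} (hE : MeasurableSet E) :
    P₁ {ω | pre k (path Z ω) ∈ E} =
      ∫⁻ ω in {ω | pre k (path Z ω) ∈ E}, ENNReal.ofReal (M.lr k (pre k (path Z ω))) ∂P₀ := by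
  have hp : Measurable fun ω => pre k (path Z ω) :=
    (measurable_pre k).comp (measurable_path h₁.measurable)
  have h := Measure.map_apply (μ := P₁) hp hE
  rw [M.map_pre_signal h₀ h₁ hM hlog₁ k, withDensity_apply _ hE,
    setLIntegral_map hE (M.measurable_lr k).ennreal_ofReal hp] at h
  exact h.symm

omit [MeasurableSpace Ω] in
theorem SeqTest.disjoint_of_subset_stopSet (T : SeqTest 𝒵) {E : (k : ℕ) → Set (Fin k → 𝒵)}
    (hE : ∀ k, E k ⊆ T.stopSet k) :
    Pairwise (Function.onFun Disjoint fun k => {ω : Ω | pre k (path Z ω) ∈ E k}) := by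
  intro k n hkn
  refine disjoint_left.2 fun ω hk hn => hkn ?_
  have h1 := (T.time_eq_coe_iff (path Z ω) k).2 (hE k hk)
  have h2 := (T.time_eq_coe_iff (path Z ω) n).2 (hE n hn)
  rw [h1] at h2
  exact_mod_cast h2

/-- Change of measure at the stopping time of a test, from signal to noise. -/
theorem SeqTest.measure_noise_le (T : SeqTest 𝒵) (h₀ : M.IsNoise P₀ Z) (h₁ : M.IsSignal P₁ X Z)
    (hM : M.Ergodic) (hlog₁ : M.FiniteLogMoment P₁ Z) {E : (k : ℕ) → Set (Fin k → 𝒵)}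
    (hEm : ∀ k, MeasurableSet (E k)) (hE : ∀ k, E k ⊆ T.stopSet k) {K : ℝ} (hK : 0 ≤ K)
    (hlr : ∀ k, ∀ z ∈ E k, 1 ≤ K * M.lr k z) :
    P₀ (⋃ k, {ω | pre k (path Z ω) ∈ E k}) ≤
      ENNReal.ofReal K * P₁ (⋃ k, {ω | pre k (path Z ω) ∈ E k}) := by
  have hm : ∀ k, MeasurableSet {ω | pre k (path Z ω) ∈ E k} := fun k =>
    ((measurable_pre k).comp (measurable_path h₁.measurable)) (hEm k)
  have hd := T.disjoint_of_subset_stopSet (Z := Z) hE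
  rw [measure_iUnion hd hm, measure_iUnion hd hm,
    ← ENNReal.tsum_mul_left]
  refine ENNReal.tsum_le_tsum fun k => ?_
  have hmeas : Measurable fun ω => ENNReal.ofReal (M.lr k (pre k (path Z ω))) :=
    (M.measurable_pathLr_path (ν := ν) h₁.measurable k).ennreal_ofReal
  rw [M.measure_signal_pre h₀ h₁ hM hlog₁ (hEm k), ← lintegral_const_mul _ hmeas,
    ← setLIntegral_one]
  refine setLIntegral_mono (hmeas.const_mul _) fun ω hω => ?_
  rw [← ENNReal.ofReal_mul hK, ← ENNReal.ofReal_one]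
  exact ENNReal.ofReal_le_ofReal (hlr k _ hω)

/-- Change of measure at the stopping time of a test, from noise to signal. -/
theorem SeqTest.measure_signal_le (T : SeqTest 𝒵) (h₀ : M.IsNoise P₀ Z) (h₁ : M.IsSignal P₁ X Z)
    (hM : M.Ergodic) (hlog₁ : M.FiniteLogMoment P₁ Z) {E : (k : ℕ) → Set (Fin k → 𝒵)}
    (hEm : ∀ k, MeasurableSet (E k)) (hE : ∀ k, E k ⊆ T.stopSet k) {K : ℝ}
    (hlr : ∀ k, ∀ z ∈ E k, M.lr k z ≤ K) :
    P₁ (⋃ k, {ω | pre k (path Z ω) ∈ E k}) ≤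
      ENNReal.ofReal K * P₀ (⋃ k, {ω | pre k (path Z ω) ∈ E k}) := by
  have hm : ∀ k, MeasurableSet {ω | pre k (path Z ω) ∈ E k} := fun k =>
    ((measurable_pre k).comp (measurable_path h₁.measurable)) (hEm k)
  have hd := T.disjoint_of_subset_stopSet (Z := Z) hE
  rw [measure_iUnion hd hm, measure_iUnion hd hm,
    ← ENNReal.tsum_mul_left]
  refine ENNReal.tsum_le_tsum fun k => ?_
  rw [M.measure_signal_pre h₀ h₁ hM hlog₁ (hEm k), ← setLIntegral_const]
  exact setLIntegral_mono measurable_const fun ω hω => ENNReal.ofReal_le_ofReal (hlr k _ hω)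

/-- Split by the decision. A wrong one is counted by the first error probability. With a decision
for noise and $\Lambda\ge e^{-C}$, the event is at most $e^C$ times as likely under noise as under
signal, where it is an error of the second kind. -/
theorem SeqTest.noise_measure_decided_early_le (T : SeqTest 𝒵) (h₀ : M.IsNoise P₀ Z)
    (h₁ : M.IsSignal P₁ X Z) (hM : M.Ergodic) (hlog₀ : M.FiniteLogMoment P₀ Z)
    (hlog₁ : M.FiniteLogMoment P₁ Z) (C : ℝ) :
    P₀ {ω | ∃ k : ℕ, T.time (path Z ω) = k ∧ -C ≤ Real.log (M.pathLr k (path Z ω))} ≤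
      ENNReal.ofReal (Real.exp C) * T.errII P₁ Z + T.errI P₀ Z := by
  set E : (k : ℕ) → Set (Fin k → 𝒵) := fun k =>
    (T.stopSet k ∩ (T.accept k)ᶜ) ∩ {z | Real.exp (-C) ≤ M.lr k z}
  have hle := T.measure_noise_le h₀ h₁ hM hlog₁ (E := E)
    (fun k => ((T.measurableSet_stopSet k).inter (T.accept_measurable k).compl).inter
      (measurableSet_le measurable_const (M.measurable_lr k)))
    (fun k z hz => hz.1.1) (Real.exp_pos C).le (fun k z hz => by
      have : Real.exp (-C) ≤ M.lr k z := hz.2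
      calc (1 : ℝ) = Real.exp C * Real.exp (-C) := by rw [← Real.exp_add]; simp
        _ ≤ _ := by gcongr)
  have hII : P₁ (⋃ k, {ω | pre k (path Z ω) ∈ E k}) ≤ T.errII P₁ Z := by
    refine measure_mono (iUnion_subset fun k ω hω => ⟨k, ?_, hω.1.2⟩)
    exact (T.time_eq_coe_iff (path Z ω) k).2 hω.1.1
  have hpos : ∀ᵐ ω ∂P₀, ∀ k, 0 < M.pathLr k (path Z ω) :=
    M.ae_pathLr_pos h₀.measurable hlog₀ h₀.measurePreserving_shift
  calc _ ≤ P₀ ((⋃ k, {ω | pre k (path Z ω) ∈ E k}) ∪ {ω | ∃ k : ℕ,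
        T.time (path Z ω) = k ∧ pre k (path Z ω) ∈ T.accept k}) := by
        refine measure_mono_ae ?_
        filter_upwards [hpos] with ω hω ⟨k, hk, hk'⟩
        by_cases hacc : pre k (path Z ω) ∈ T.accept k
        · exact Or.inr ⟨k, hk, hacc⟩
        · refine Or.inl (mem_iUnion.2 ⟨k, ⟨(T.time_eq_coe_iff _ _).1 hk, hacc⟩, ?_⟩)
          exact (Real.le_log_iff_exp_le (hω k)).1 hk'
    _ ≤ _ := (measure_union_le _ _).trans (add_le_add (hle.trans (by gcongr)) le_rfl)

/-- The mirror image: decisions for signal with $\Lambda\le e^C$ are transferred to noise, where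
they are errors of the first kind. -/
theorem SeqTest.signal_measure_decided_early_le (T : SeqTest 𝒵) (h₀ : M.IsNoise P₀ Z)
    (h₁ : M.IsSignal P₁ X Z) (hM : M.Ergodic)
    (hlog₁ : M.FiniteLogMoment P₁ Z) (C : ℝ) :
    P₁ {ω | ∃ k : ℕ, T.time (path Z ω) = k ∧ -C ≤ -Real.log (M.pathLr k (path Z ω))} ≤
      ENNReal.ofReal (Real.exp C) * T.errI P₀ Z + T.errII P₁ Z := by
  set E : (k : ℕ) → Set (Fin k → 𝒵) := fun k =>
    (T.stopSet k ∩ T.accept k) ∩ {z | M.lr k z ≤ Real.exp C}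
  have hle := T.measure_signal_le h₀ h₁ hM hlog₁ (E := E)
    (fun k => ((T.measurableSet_stopSet k).inter (T.accept_measurable k)).inter
      (measurableSet_le (M.measurable_lr k) measurable_const))
    (fun k z hz => hz.1.1) (fun k z hz => hz.2)
  have hI : P₀ (⋃ k, {ω | pre k (path Z ω) ∈ E k}) ≤ T.errI P₀ Z := by
    refine measure_mono (iUnion_subset fun k ω hω => ⟨k, ?_, hω.1.2⟩)
    exact (T.time_eq_coe_iff (path Z ω) k).2 hω.1.1
  have hpos : ∀ᵐ ω ∂P₁, ∀ k, 0 < M.pathLr k (path Z ω) :=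
    M.ae_pathLr_pos h₁.measurable hlog₁ (h₁.measurePreserving_shift hM.stationary)
  calc _ ≤ P₁ ((⋃ k, {ω | pre k (path Z ω) ∈ E k}) ∪ {ω | ∃ k : ℕ,
        T.time (path Z ω) = k ∧ pre k (path Z ω) ∉ T.accept k}) := by
        refine measure_mono_ae ?_
        filter_upwards [hpos] with ω hω ⟨k, hk, hk'⟩
        by_cases hacc : pre k (path Z ω) ∈ T.accept k
        · refine Or.inl (mem_iUnion.2 ⟨k, ⟨(T.time_eq_coe_iff _ _).1 hk, hacc⟩, ?_⟩)
          exact (Real.log_le_iff_le_exp (hω k)).1 (neg_le_neg_iff.1 hk')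
        · exact Or.inr ⟨k, hk, hacc⟩
    _ ≤ _ := (measure_union_le _ _).trans (add_le_add (hle.trans (by gcongr)) le_rfl)

end Tests

/-! ### Asymptotics of the thresholds and the stopping time of the SPRT in logarithmic form. -/

section Optimality

theorem tendsto_neg_log_atTop {J : Type*} {l : Filter J} {α β : J → ℝ} (hα : ∀ j, 0 < α j)
    (hβ : ∀ j, 0 < β j) (h : Tendsto (fun j => α j + β j) l (𝓝 0)) :
    Tendsto α l (𝓝 0) ∧ Tendsto (fun j => -Real.log (α j)) l atTop := by
  have h0 : Tendsto α l (𝓝 0) := squeeze_zero (fun j => (hα j).le)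
    (fun j => le_add_of_nonneg_right (hβ j).le) h
  refine ⟨h0, tendsto_neg_atBot_atTop.comp (Real.tendsto_log_nhdsGT_zero.comp ?_)⟩
  exact tendsto_nhdsWithin_iff.2 ⟨h0, Eventually.of_forall hα⟩

theorem tendsto_div_one_of_isEquivalent {J : Type*} {l : Filter J} {a b : J → ℝ}
    (h : Asymptotics.IsEquivalent l b a) (ha : ∀ j, a j ≠ 0) :
    Tendsto (fun j => b j / a j) l (𝓝 1) :=
  (Asymptotics.isEquivalent_iff_tendsto_one (Eventually.of_forall ha)).1 h

theorem tendsto_atTop_of_div_tendsto_one {J : Type*} {l : Filter J} {a b : J → ℝ}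
    (ha : Tendsto a l atTop) (h : Tendsto (fun j => b j / a j) l (𝓝 1)) : Tendsto b l atTop := by
  refine (h.pos_mul_atTop one_pos ha).congr' ?_
  filter_upwards [ha.eventually_gt_atTop 0] with j hj
  field_simp

variable {S : Type*} [Fintype S] [DecidableEq S] {𝒵 : Type*} [MeasurableSpace 𝒵] {ν : Measure 𝒵}
  {M : Model S 𝒵 ν}

theorem Model.time_sprt_le {γ₀ γ₁ : ℝ} {z : ℕ → 𝒵} {n : ℕ} (hn : 1 ≤ n)
    (h : M.pathLr n z ∉ Ioo γ₀ γ₁) : (M.sprt γ₀ γ₁).time z ≤ n :=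
  iInf₂_le n ⟨hn, h⟩

theorem Model.time_sprt_eq {γ₀ γ₁ : ℝ} (h₀ : 0 < γ₀) (h₁ : 0 < γ₁) {z : ℕ → 𝒵}
    (hz : ∀ k, 0 < M.pathLr k z) :
    (M.sprt γ₀ γ₁).time z = ⨅ (k : ℕ) (_ : 1 ≤ k ∧ (Real.log (M.pathLr k z) ≤ Real.log γ₀ ∨
      Real.log γ₁ ≤ Real.log (M.pathLr k z))), (k : ℕ∞) := by
  have : ∀ k, (1 ≤ k ∧ pre k z ∈ (M.sprt γ₀ γ₁).halt k) ↔
      (1 ≤ k ∧ (Real.log (M.pathLr k z) ≤ Real.log γ₀ ∨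
        Real.log γ₁ ≤ Real.log (M.pathLr k z))) := fun k => by
    refine and_congr_right fun _ => ?_
    rw [Real.log_le_log_iff (hz k) h₀, Real.log_le_log_iff h₁ (hz k)]
    change M.pathLr k z ∉ Ioo γ₀ γ₁ ↔ _
    rw [mem_Ioo, not_and_or, not_lt, not_lt]
  simp only [SeqTest.time, this]

end Optimality

end SeqHMM

/-! ### Assembly of the theorem. -/

open SeqHMM in
theorem theorem2 {S : Type*} [Fintype S] [DecidableEq S]
    {𝒵 : Type*} [MeasurableSpace 𝒵] (ν : Measure 𝒵) [SigmaFinite ν] (M : Model S 𝒵 ν)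
    {Ω : Type*} [MeasurableSpace Ω] (P₀ P₁ : Measure Ω)
    [IsProbabilityMeasure P₀] [IsProbabilityMeasure P₁]
    (X : ℕ → Ω → S) (Z : ℕ → Ω → 𝒵)
    (hH₀ : M.IsNoise P₀ Z) (hH₁ : M.IsSignal P₁ X Z)
    (hergodic : M.Ergodic) (hmixture : M.Distinguishable)
    (hlog₀ : M.FiniteLogMoment P₀ Z) (hlog₁ : M.FiniteLogMoment P₁ Z) :
    ∃ lam₀ lam₁ : ℝ, lam₀ < 0 ∧ 0 < lam₁ ∧
      M.IsLogRate P₀ Z lam₀ ∧ M.IsLogRate P₁ Z lam₁ ∧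
      ∀ {J : Type*} (l : Filter J) (α β γ₀ γ₁ : J → ℝ),
        (∀ j, α j ∈ Ioo (0 : ℝ) 1) → (∀ j, β j ∈ Ioo (0 : ℝ) 1) →
        Tendsto (fun j => α j + β j) l (𝓝 0) →
        (∀ j, 0 < γ₀ j) → (∀ j, γ₀ j < 1) → (∀ j, 1 < γ₁ j) →
        (∀ j, M.sprt (γ₀ j) (γ₁ j) ∈ testClass P₀ P₁ Z (α j) (β j)) →
        Asymptotics.IsEquivalent l (fun j => Real.log (γ₁ j)) (fun j => Real.log (1 / α j)) →
        Asymptotics.IsEquivalent l (fun j => Real.log (γ₀ j)) (fun j => Real.log (β j)) →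
        (∀ᵐ ω ∂P₀, Tendsto
          (fun j => ((M.sprt (γ₀ j) (γ₁ j)).time (fun i => Z i ω) : ℝ≥0∞) /
            ENNReal.ofReal |Real.log (β j)|) l (𝓝 (ENNReal.ofReal (1 / |lam₀|)))) ∧
        (∀ᵐ ω ∂P₁, Tendsto
          (fun j => ((M.sprt (γ₀ j) (γ₁ j)).time (fun i => Z i ω) : ℝ≥0∞) /
            ENNReal.ofReal |Real.log (α j)|) l (𝓝 (ENNReal.ofReal (1 / lam₁)))) ∧
        ∀ ε ∈ Ioo (0 : ℝ) 1, ∀ P : Measure Ω, (P = P₀ ∨ P = P₁) →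
          Tendsto (fun j => ⨅ T ∈ testClass P₀ P₁ Z (α j) (β j),
            P {ω | ENNReal.ofReal ε *
                ((M.sprt (γ₀ j) (γ₁ j)).time (fun i => Z i ω) : ℝ≥0∞) <
              (T.time (fun i => Z i ω) : ℝ≥0∞)}) l (𝓝 1) := by
  have hZ₀ := hH₀.measurable
  have hμ₁ := hH₁.measurePreserving_shift hergodic.stationary
  obtain ⟨lam₀, hrate₀, hlim₀⟩ := M.exists_isLogRate hergodic hZ₀ hlog₀ hH₀.ergodic_shift
  obtain ⟨lam₁, hrate₁, hlim₁⟩ := M.exists_isLogRate hergodic hZ₀ hlog₁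
    (Model.IsSignal.ergodic_shift hH₀ hH₁ hergodic hlog₀ hlog₁)
  have hneg := M.logRate_noise_neg hH₀ hH₁ hergodic hmixture hlog₀ hlog₁ hrate₀
  have hpos := M.logRate_signal_pos hH₀ hH₁ hergodic hmixture hlog₁ hrate₁
  have hΛ₀ := M.ae_pathLr_pos hZ₀ hlog₀ hH₀.measurePreserving_shift
  have hΛ₁ := M.ae_pathLr_pos hZ₀ hlog₁ hμ₁
  refine ⟨lam₀, lam₁, hneg, hpos, hrate₀, hrate₁, ?_⟩
  intro J l α β γ₀ γ₁ hα hβ hαβ hγ₀ hγ₀1 hγ₁ hclass hequiv₁ hequiv₀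
  have hlim₁' : ∀ᵐ ω ∂P₁, Tendsto (fun k : ℕ => -Real.log (M.pathLr k (path Z ω)) / k) atTop
      (𝓝 (-lam₁)) := by
    filter_upwards [hlim₁] with ω hω
    simpa only [neg_div] using hω.neg
  have hγ₁0 : ∀ j, 0 < γ₁ j := fun j => one_pos.trans (hγ₁ j)
  have hlogα : ∀ j, Real.log (α j) < 0 := fun j => Real.log_neg (hα j).1 (hα j).2
  have hlogβ : ∀ j, Real.log (β j) < 0 := fun j => Real.log_neg (hβ j).1 (hβ j).2
  obtain ⟨hα0, hαtop⟩ := tendsto_neg_log_atTop (fun j => (hα j).1) (fun j => (hβ j).1) hαβ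
  obtain ⟨hβ0, hβtop⟩ := tendsto_neg_log_atTop (fun j => (hβ j).1) (fun j => (hα j).1)
    (hαβ.congr fun j => add_comm _ _)
  have hr₁ : Tendsto (fun j => Real.log (γ₁ j) / -Real.log (α j)) l (𝓝 1) := by
    simp only [one_div, Real.log_inv] at hequiv₁
    exact tendsto_div_one_of_isEquivalent hequiv₁ fun j => (neg_pos.2 (hlogα j)).ne'
  have hr₀ : Tendsto (fun j => -Real.log (γ₀ j) / -Real.log (β j)) l (𝓝 1) := by
    simpa only [neg_div_neg_eq] using
      tendsto_div_one_of_isEquivalent hequiv₀ fun j => (hlogβ j).ne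
  have hγ₁top := tendsto_atTop_of_div_tendsto_one hαtop hr₁
  have hγ₀top := tendsto_atTop_of_div_tendsto_one hβtop hr₀
  have hmeas : ∀ k, Measurable fun ω => Real.log (M.pathLr k (path Z ω)) := fun k =>
    (M.measurable_pathLr_path (ν := ν) hZ₀ k).log
  -- An infimum over an empty class would be $\infty$ rather than at most $1$.
  have hne : ∀ j, (testClass P₀ P₁ Z (α j) (β j)).Nonempty := fun j => ⟨_, hclass j⟩
  refine ⟨?_, ?_, ?_⟩
  · simp_rw [fun j => abs_of_neg (hlogβ j)]
    filter_upwards [hlim₀, hΛ₀] with ω hω hpω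
    refine tendsto_exit_time hneg hω hγ₀top hγ₁top hβtop hr₀ fun j => ?_
    rw [neg_neg]
    exact M.time_sprt_eq (hγ₀ j) (hγ₁0 j) hpω
  · simp_rw [fun j => abs_of_neg (hlogα j)]
    filter_upwards [hlim₁', hΛ₁] with ω hω hpω
    -- Under signal $-\ln\Lambda$ has negative drift, and the two boundaries exchange roles.
    have := tendsto_exit_time (neg_lt_zero.2 hpos) hω hγ₁top hγ₀top hαtop hr₁
      (τ := fun j => (M.sprt (γ₀ j) (γ₁ j)).time (path Z ω)) fun j => by
        rw [M.time_sprt_eq (hγ₀ j) (hγ₁0 j) hpω]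
        simp only [neg_le_neg_iff]
        simp only [or_comm]
    rwa [abs_neg, abs_of_pos hpos] at this
  · intro ε hε P hP
    rcases hP with rfl | rfl
    · refine tendsto_iInf_measure_lt (u := fun k ω => Real.log (M.pathLr k (path Z ω)))
        (τ := fun j ω => (M.sprt (γ₀ j) (γ₁ j)).time (path Z ω))
        (N := fun T ω => T.time (path Z ω)) (e := fun j => ENNReal.ofReal (α j)) hneg hmeas hlim₀
        hβtop hr₀ (by simpa using ENNReal.tendsto_ofReal hα0) ?_ hne ?_ hε
      · intro j n ω hn hu
        -- This is required for every $\omega$, even where $\Lambda_n=0$ and the logarithm is a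
        -- default value; membership in $(\gamma_0,\gamma_1)$ already forces $\Lambda_n>0$.
        refine M.time_sprt_le hn fun hmem => ?_
        rw [neg_neg] at hu
        exact absurd (Real.log_lt_log (hγ₀ j) hmem.1) hu.not_gt
      · intro j T hT C
        refine (T.noise_measure_decided_early_le hH₀ hH₁ hergodic hlog₀ hlog₁ C).trans ?_
        -- With $a=-\ln\beta'$ the bound $e^{C-a}$ is exactly $e^C\beta'$.
        rw [sub_neg_eq_add, Real.exp_add, Real.exp_log (hβ j).1,
          ENNReal.ofReal_mul (Real.exp_pos C).le]
        exact add_le_add (mul_le_mul_right hT.2 _) hT.1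
    · refine tendsto_iInf_measure_lt (u := fun k ω => -Real.log (M.pathLr k (path Z ω)))
        (τ := fun j ω => (M.sprt (γ₀ j) (γ₁ j)).time (path Z ω))
        (N := fun T ω => T.time (path Z ω)) (e := fun j => ENNReal.ofReal (β j))
        (neg_lt_zero.2 hpos) (fun k => (hmeas k).neg) hlim₁'
        hαtop hr₁ (by simpa using ENNReal.tendsto_ofReal hβ0) ?_ hne ?_ hε
      · intro j n ω hn hu
        refine M.time_sprt_le hn fun hmem => ?_
        exact absurd (Real.log_lt_log ((hγ₀ j).trans hmem.1) hmem.2) (neg_le_neg_iff.1 hu).not_gt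
      · intro j T hT C
        refine (T.signal_measure_decided_early_le hH₀ hH₁ hergodic hlog₁ C).trans ?_
        rw [sub_neg_eq_add, Real.exp_add, Real.exp_log (hα j).1,
          ENNReal.ofReal_mul (Real.exp_pos C).le]
        exact add_le_add (mul_le_mul_right hT.1 _) hT.2
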